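/- All spaces are metrizable. An arc is a space homeomorphic to $[0,1]$, a ray is a space homeomorphic to $[0,\infty)$ (its end point corresponds to $0$), a free interval is an open subset homeomorphic to $(0,1)$, and a continuum is a nonempty compact connected metrizable space. A compactification of a ray $S$ with arc remainder is a compact space $A\sqcup S$ in which $S$ is dense and $A$ is an arc. For a space $Y$ let $\mathcal M(Y)$ be the system of all nonempty compact sets $M\subseteq Y$ for which there is a continuous map $f\colon Y\to Y$ with $f(M)=M$ such that no nonempty proper closed subset $N$ of $M$ satisfies $f(N)\subseteq N$. Let $\mathcal C$ be the class of all continua $X=L\cup J\cup R$ such that $J$ is a free interval dense in $X$, and $L,R$ are (nowhere dense) locally connected continua disjoint from $J$ such that, for some rays $J_L,J_R$ with $J=J_L\cup J_R$, the space $L\cup J_L$ is a compactification of $J_L$ and $R\cup J_R$ is a compactification of $J_R$. There is a continuum $X\in\mathcal C$, $X=L\cup J\cup R$, with nondegenerate disjoint remainders $L,R$ that are arcs, such that $$\mathcal M(X)=\mathcal M(J)\sqcup\mathcal M(L)\sqcup\mathcal M(R),$$ i.e. no minimal set on $X$ meets both $L$ and $R$. More precisely: (1) There are a metrizable space $X$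 and compactifications $X_L=L\sqcup J_L$, $X_R=R\sqcup J_R$ of rays $J_L,J_R$ with arc remainders $L,R$, both subspaces of $X$, such that $X=X_L\cup X_R$, $X_L\cap X_R=\{x_0\}$, where $x_0$ is the end point of both rays $J_L$ and $J_R$, and neither of $X_L,X_R$ maps continuously onto the other. (2) Whenever $X,L,J_L,J_R,R,x_0$ are as in (1), then with $J=J_L\cup J_R$ the space $X=L\cup J\cup R$ belongs to $\mathcal C$, its remainders $L,R$ are nondegenerate disjoint arcs, $\mathcal M(X)=\mathcal M(J)\sqcup\mathcal M(L)\sqcup\mathcal M(R)$ (a disjoint union), and no $M\in\mathcal M(X)$ meets both $L$ and $R$. -/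

import Mathlib

open Set Topology TopologicalSpace

namespace DenseFreeInterval

/-! All spaces below are subspaces of one ambient metrizable space `X`. -/

section

variable {X : Type*} [TopologicalSpace X]

/-- An arc: homeomorphic to `[0, 1]`. -/
def IsArc (A : Set X) : Prop := Nonempty (A ≃ₜ Icc (0 : ℝ) 1)

/-- A ray: homeomorphic to `[0, ∞)`. -/
def IsRay (S : Set X) : Prop := Nonempty (S ≃ₜ Ici (0 : ℝ))

/-- `S` is a ray whose end point is `x`. -/
def IsRayFrom (S : Set X) (x : X) : Prop :=
  ∃ (h : S ≃ₜ Ici (0 : ℝ)) (hx : x ∈ S), (h ⟨x, hx⟩ : ℝ) = 0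

/-- A free interval: an open set homeomorphic to `(0, 1)`. -/
def IsFreeInterval (J : Set X) : Prop := IsOpen J ∧ Nonempty (J ≃ₜ Ioo (0 : ℝ) 1)

/-- The subspace `K` is a compactification of its subspace `S`: it is compact and `S` is dense
in it. -/
def IsCompactificationOf (K S : Set X) : Prop := IsCompact K ∧ S ⊆ K ∧ K ⊆ closure S

/-- A locally connected continuum in the (metrizable) space `X`. -/
def IsLocallyConnectedContinuum (K : Set X) : Prop :=
  IsCompact K ∧ IsConnected K ∧ LocallyConnectedSpace K

/-- `M` is a (nonempty, compact) minimal set of the map `f`: `f (M) = M` and no nonempty proper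
closed subset `N` of `M` satisfies `f (N) ⊆ N`. -/
def IsMinimalSetOf (f : X → X) (M : Set X) : Prop :=
  M.Nonempty ∧ IsCompact M ∧ f '' M = M ∧
    ∀ N : Set X, N ⊆ M → N.Nonempty → IsClosed N → f '' N ⊆ N → N = M

/-- The system `𝓜(Y)` of all compact minimal sets of continuous maps `Y → Y`, for a subspace `Y`
of `X`. A continuous self-map of `Y` is given by a function on `X` that is continuous on `Y` and
maps `Y` into `Y`; its values outside `Y` are irrelevant. -/
def minimalSets (Y : Set X) : Set (Set X) :=
  {M | M ⊆ Y ∧ ∃ f : X → X, ContinuousOn f Y ∧ MapsTo f Y Y ∧ IsMinimalSetOf f M}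

/-- The subspace `A` maps continuously onto the subspace `B`. -/
def MapsContinuouslyOnto (A B : Set X) : Prop := ∃ f : X → X, ContinuousOn f A ∧ f '' A = B

/-- `X = L ∪ J ∪ R` belongs to the class `𝒞`: `X` is a continuum with a dense free interval `J`
and left and right remainders `L` and `R`. -/
structure IsInClassC (L J R : Set X) : Prop where
  metrizable : MetrizableSpace X
  compact : CompactSpace X
  connected : ConnectedSpace X
  cover : L ∪ J ∪ R = univ
  freeInterval : IsFreeInterval J
  dense : Dense J
  left_continuum : IsLocallyConnectedContinuum L
  right_continuum : IsLocallyConnectedContinuum R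
  left_nowhereDense : IsNowhereDense L
  right_nowhereDense : IsNowhereDense R
  left_disjoint : Disjoint L J
  right_disjoint : Disjoint R J
  exists_rays : ∃ JL JR : Set X, IsRay JL ∧ IsRay JR ∧ J = JL ∪ JR ∧
    IsCompactificationOf (L ∪ JL) JL ∧ IsCompactificationOf (R ∪ JR) JR

/-- `K = A ∪ S` is a compactification of the ray `S` with end point `x`, and its remainder `A`
is an arc. -/
structure IsRayCompactificationWithArcRemainder (A S : Set X) (x : X) : Prop where
  ray : IsRayFrom S x
  arc : IsArc A
  disjoint : Disjoint A S
  compactification : IsCompactificationOf (A ∪ S) S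

/-- The metrizable space `X` is the union of the two compact subspaces `L ∪ JL` and `R ∪ JR`, each
a compactification of a ray (`JL`, `JR`) with an arc (`L`, `R`) as remainder, which have only the
common end point `x₀` of the two rays in common; that is, `X` results from gluing these two ray
compactifications at their end points. -/
structure IsGluingOfRayCompactifications (L JL JR R : Set X) (x₀ : X) : Prop where
  metrizable : MetrizableSpace X
  left : IsRayCompactificationWithArcRemainder L JL x₀
  right : IsRayCompactificationWithArcRemainder R JR x₀
  cover : (L ∪ JL) ∪ (R ∪ JR) = univ
  inter : (L ∪ JL) ∩ (R ∪ JR) = {x₀}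

end

end DenseFreeInterval

open DenseFreeInterval

/-!
**Minimal sets of a glued space.** The glued space `X` carries a continuous coordinate
`κ : X → [-1, 1]` with fibres `L` over `-1` and `R` over `1` and with a section over `(-1, 1)`
(`exists_intervalCoordinate`). A path that leaves the interval would have to oscillate over a whole
remainder, so the path components of `X` are `L`, `R` and the interval `J`
(`IsIntervalCoordinate.subset_of_isPathConnected`), and a continuous `f : X → X` maps each of them
into one of them. Let `M` be minimal for `f`. If `f` does not map `J` into itself, it maps `J`, hence
`X`, into `L` or `R`. Otherwise only points of `L ∪ R` can be mapped into `L`. Hence, if `M` meets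
`L`, then either `f` maps `L` into `L`, and then `M ∩ L` is invariant, so `M ⊆ L`; or `f` maps `R`
into `L`. In the latter case `f` reverses `J`, the image of the right half of `X` contains all points
near `L`, and stretching it gives a map of one ray compactification onto the other
(`IsIntervalCoordinate.mapsContinuouslyOnto_of_image_right`), which is excluded. That the minimal
sets of `X` inside `J`, `L` or `R` are those of the respective subspace follows by composing with
retractions (`mem_minimalSets_iff_of_subset`).

**Incomparable compactifications.** For a walk `w` on four positions take the closure in the plane of
a ray which approaches the line `x = 1` while oscillating longer and longer over the edges
`[2 * w i, 2 * w i + 1]` for `i = 0, 1, 2, …` in turn (`zigzagCompactum`). A map of the compactum of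
`w` onto that of `v` consists of a map `α` of the remainders and a map `τ` of the rays which
asymptotically fit together (`IsAsymptoticFactor`). As `α` is uniformly continuous, crossing a long
block of `v`, where the ray oscillates over one edge, takes long, so that meanwhile `w` passes through
a whole edge; hence `α` maps this edge into a neighborhood of the crossed one, and it permutes the
four edges up to small errors. Following three consecutive blocks of `v` at positions `p', p, p'`, one
finds a turn of the same kind in `w`, up to the permutation
(`IsAsymptoticFactor.exists_injective_turns`). Any permutation preserves coincidences between turns,
and these obstruct maps in both directions between the walks `lowTurnCycle` and `highTurnCycle`.
-/

/-! ### A real coordinate on the glued space -/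

section Coordinate

variable {X : Type*} [TopologicalSpace X]

/-- A ray compactification `A ∪ S` has a continuous coordinate `g` with values in `[0, 1]` which is
`1` exactly on the remainder and parametrizes the ray by `[0, 1)`; its inverse is `e`. Below `0` the
map `e` is constant. -/
lemma exists_coordinate_of_rayCompactification [T2Space X] {A S : Set X} {x₀ : X}
    (h : IsRayCompactificationWithArcRemainder A S x₀) :
    ∃ (g : X → ℝ) (e : ℝ → X), ContinuousOn g (A ∪ S) ∧ (∀ x ∈ A, g x = 1) ∧
      (∀ x ∈ S, g x ∈ Ico (0 : ℝ) 1) ∧ ContinuousOn e (Iio 1) ∧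
      (∀ s ∈ Ico (0 : ℝ) 1, e s ∈ S ∧ g (e s) = s) ∧ (∀ x ∈ S, e (g x) = x) ∧
      (∀ s ≤ 0, e s = x₀) ∧ g x₀ = 0 := by
  classical
  obtain ⟨⟨hS, hx₀, h0⟩, ⟨hA⟩, hd, hK, -, -⟩ := h
  have hAcl : IsClosed A := by
    have : CompactSpace A := hA.symm.compactSpace
    exact (isCompact_iff_compactSpace.2 this).isClosed
  set g : X → ℝ := fun x => if hx : x ∈ S then (hS ⟨x, hx⟩ : ℝ) / (1 + (hS ⟨x, hx⟩ : ℝ)) else 1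
    with hg
  set e : ℝ → X := fun s => (hS.symm ⟨max 0 (s / (1 - s)), mem_Ici.2 (le_max_left _ _)⟩ : S) with he
  have hnn : ∀ y : S, 0 ≤ (hS y : ℝ) := fun y => (hS y).2
  have gS : ∀ y : S, g y = (hS y : ℝ) / (1 + (hS y : ℝ)) := fun y => by simp [hg]
  have gA : ∀ x ∈ A, g x = 1 := fun x hx => by
    have : x ∉ S := fun h => hd.le_bot ⟨hx, h⟩
    simp [hg, this]
  have gI : ∀ x ∈ S, g x ∈ Ico (0 : ℝ) 1 := by
    intro x hx
    have := hnn ⟨x, hx⟩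
    rw [gS ⟨x, hx⟩]
    constructor
    · positivity
    · rw [div_lt_one (by positivity)]; linarith
  have eS : ∀ s, e s ∈ S := fun s => Subtype.coe_prop _
  have ge : ∀ s ∈ Ico (0 : ℝ) 1, g (e s) = s := by
    intro s hs
    have h1 : 0 < 1 - s := by linarith [hs.2]
    have h2 : max 0 (s / (1 - s)) = s / (1 - s) := max_eq_right (div_nonneg hs.1 h1.le)
    rw [he, gS, Homeomorph.apply_symm_apply]
    simp only [h2]
    field_simp
    ring
  have eg : ∀ x ∈ S, e (g x) = x := by
    intro x hx
    have h3 := hnn ⟨x, hx⟩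
    have h4 : g x / (1 - g x) = hS ⟨x, hx⟩ := by
      rw [gS ⟨x, hx⟩]
      have : 1 - (hS ⟨x, hx⟩ : ℝ) / (1 + (hS ⟨x, hx⟩ : ℝ)) = 1 / (1 + (hS ⟨x, hx⟩ : ℝ)) := by
        field_simp; ring
      rw [this]; field_simp
    have h5 : (⟨max 0 (g x / (1 - g x)), mem_Ici.2 (le_max_left _ _)⟩ : Ici (0 : ℝ)) = hS ⟨x, hx⟩ :=
      Subtype.ext (by simp only [h4]; exact max_eq_right h3)
    simp only [he, h5, Homeomorph.symm_apply_apply]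
  have econt : ContinuousOn e (Iio 1) := by
    have h1 : ContinuousOn (fun s : ℝ => s / (1 - s)) (Iio 1) := by
      refine continuousOn_id.div (by fun_prop) fun s hs => ?_
      have : s < 1 := hs
      linarith
    have h2 : Continuous fun r : ℝ => (hS.symm ⟨max 0 r, mem_Ici.2 (le_max_left _ _)⟩ : X) :=
      continuous_subtype_val.comp
        (hS.symm.continuous.comp ((continuous_const.max continuous_id).subtype_mk _))
    exact h2.comp_continuousOn h1
  have gcontS : ContinuousOn g S := by
    rw [continuousOn_iff_continuous_domRestrict]
    have : S.domRestrict g = fun y : S => (hS y : ℝ) / (1 + (hS y : ℝ)) := funext gS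
    rw [this]
    refine Continuous.div (by fun_prop) (by fun_prop) fun y => ?_
    have := hnn y; positivity
  refine ⟨g, e, ?_, gA, gI, econt, fun s hs => ⟨eS s, ge s hs⟩, eg, ?_, ?_⟩
  · rintro p (hp | hp)
    · -- the part of the ray below level `1 - ε` is compact, so its complement is a neighborhood
      rw [ContinuousWithinAt, gA p hp, Metric.tendsto_nhds]
      intro ε hε
      have hC : IsCompact (e '' Icc 0 (1 - ε)) :=
        isCompact_Icc.image_of_continuousOn
          (econt.mono fun s hs => by have := hs.2; simp only [mem_Iio]; linarith)
      have hpC : (e '' Icc 0 (1 - ε))ᶜ ∈ 𝓝[A ∪ S] p := by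
        refine mem_nhdsWithin_of_mem_nhds (hC.isClosed.isOpen_compl.mem_nhds ?_)
        rintro ⟨s, -, rfl⟩
        exact hd.le_bot ⟨hp, eS s⟩
      filter_upwards [hpC, self_mem_nhdsWithin] with x hx hxK
      rcases hxK with hxA | hxS
      · rw [gA x hxA, dist_self]; exact hε
      · have h1 := gI x hxS
        have h2 : 1 - ε < g x := by
          by_contra! hlt
          exact hx ⟨g x, ⟨h1.1, hlt⟩, eg x hxS⟩
        rw [Real.dist_eq, abs_lt]
        constructor <;> linarith [h1.2]
    · refine (gcontS p hp).mono_of_mem_nhdsWithin ?_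
      have h1 : Aᶜ ∈ 𝓝 p := hAcl.isOpen_compl.mem_nhds fun h => hd.le_bot ⟨h, hp⟩
      filter_upwards [mem_nhdsWithin_of_mem_nhds h1, self_mem_nhdsWithin] with x hx hxK
      exact hxK.resolve_left hx
  · intro s hs
    have h1 : max 0 (s / (1 - s)) = 0 :=
      max_eq_left (div_nonpos_of_nonpos_of_nonneg hs (by linarith))
    have h2 : (⟨max 0 (s / (1 - s)), mem_Ici.2 (le_max_left _ _)⟩ : Ici (0 : ℝ)) = hS ⟨x₀, hx₀⟩ :=
      Subtype.ext (by simp only [h1]; exact h0.symm)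
    simp only [he, h2, Homeomorph.symm_apply_apply]
  · rw [gS ⟨x₀, hx₀⟩, h0]; simp

/-- A coordinate on a compactification of an open interval: a continuous map `κ : X → [-1, 1]` with
a section `j` over `(-1, 1)`, such that the remainders are the fibres `L` over `-1` and `R` over `1`
and the interval, the part over `(-1, 1)`, is dense. -/
structure IsIntervalCoordinate (L R : Set X) (κ : X → ℝ) (j : ℝ → X) : Prop where
  continuous : Continuous κ
  mem_Icc : ∀ x, κ x ∈ Icc (-1 : ℝ) 1
  left : ∀ x, x ∈ L ↔ κ x = -1
  right : ∀ x, x ∈ R ↔ κ x = 1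
  continuousOn_section : ContinuousOn j (Ioo (-1) 1)
  apply_section : ∀ s ∈ Ioo (-1 : ℝ) 1, κ (j s) = s
  section_apply : ∀ x, κ x ∈ Ioo (-1 : ℝ) 1 → j (κ x) = x
  dense : Dense (κ ⁻¹' Ioo (-1) 1)

lemma DenseFreeInterval.IsGluingOfRayCompactifications.symm {L JL JR R : Set X} {x₀ : X}
    (h : IsGluingOfRayCompactifications L JL JR R x₀) :
    IsGluingOfRayCompactifications R JR JL L x₀ where
  metrizable := h.metrizable
  left := h.right
  right := h.left
  cover := by rw [union_comm, h.cover]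
  inter := by rw [inter_comm, h.inter]

lemma DenseFreeInterval.IsArc.isCompact {A : Set X} (h : IsArc A) : IsCompact A := by
  obtain ⟨h⟩ := h
  have : CompactSpace A := h.symm.compactSpace
  exact isCompact_iff_compactSpace.2 this

/-- The coordinates of the two ray compactifications, one of them with its sign reversed, fit
together at the common end point of the rays. -/
lemma exists_intervalCoordinate {L JL JR R : Set X} {x₀ : X}
    (h : IsGluingOfRayCompactifications L JL JR R x₀) :
    ∃ (κ : X → ℝ) (j : ℝ → X), IsIntervalCoordinate L R κ j ∧ L ∪ JL = κ ⁻¹' Iic 0 ∧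
      R ∪ JR = κ ⁻¹' Ici 0 ∧ JL = κ ⁻¹' Ioc (-1) 0 ∧ JR = κ ⁻¹' Ico 0 1 := by
  classical
  have := h.metrizable
  obtain ⟨gl, el, glc, glL, glJ, elc, gel, egl, el0, gl0⟩ :=
    exists_coordinate_of_rayCompactification h.left
  obtain ⟨gr, er, grc, grR, grJ, erc, ger, egr, er0, gr0⟩ :=
    exists_coordinate_of_rayCompactification h.right
  have hx₀L : x₀ ∈ JL := by obtain ⟨_, hx, _⟩ := h.left.ray; exact hx
  have hx₀R : x₀ ∈ JR := by obtain ⟨_, hx, _⟩ := h.right.ray; exact hx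
  have hcov : ∀ x, (x ∈ L ∨ x ∈ JL) ∨ (x ∈ R ∨ x ∈ JR) := fun x => by
    have : x ∈ (L ∪ JL) ∪ (R ∪ JR) := by rw [h.cover]; trivial
    exact this
  have hint : ∀ x, (x ∈ L ∨ x ∈ JL) → (x ∈ R ∨ x ∈ JR) → x = x₀ := fun x h1 h2 => by
    have : x ∈ (L ∪ JL) ∩ (R ∪ JR) := ⟨h1, h2⟩
    rw [h.inter] at this; exact this
  set κ : X → ℝ := fun x => if x ∈ L ∪ JL then -gl x else gr x with hκ
  set j : ℝ → X := fun s => if s ≤ 0 then el (-s) else er s with hj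
  have κl : ∀ x, (x ∈ L ∨ x ∈ JL) → κ x = -gl x := fun x hx => if_pos hx
  have κr : ∀ x, (x ∈ R ∨ x ∈ JR) → κ x = gr x := by
    intro x hx
    by_cases hl : x ∈ L ∨ x ∈ JL
    · rw [κl x hl, hint x hl hx, gl0, gr0, neg_zero]
    · exact if_neg hl
  have vL : ∀ x ∈ L, κ x = -1 := fun x hx => by rw [κl x (.inl hx), glL x hx]
  have vR : ∀ x ∈ R, κ x = 1 := fun x hx => by rw [κr x (.inl hx), grR x hx]
  have vJL : ∀ x ∈ JL, -1 < κ x ∧ κ x ≤ 0 := fun x hx => by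
    have := glJ x hx
    rw [κl x (.inr hx)]; exact ⟨by linarith [this.2], by linarith [this.1]⟩
  have vJR : ∀ x ∈ JR, 0 ≤ κ x ∧ κ x < 1 := fun x hx => by
    rw [κr x (.inr hx)]; exact grJ x hx
  have jl : ∀ s ∈ Ioc (-1 : ℝ) 0, j s ∈ JL ∧ κ (j s) = s := by
    intro s hs
    have h1 : j s = el (-s) := if_pos hs.2
    obtain ⟨h2, h3⟩ := gel (-s) ⟨by linarith [hs.2], by linarith [hs.1]⟩
    rw [h1]
    exact ⟨h2, by rw [κl _ (.inr h2), h3, neg_neg]⟩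
  have jr' : ∀ s, 0 ≤ s → j s = er s := by
    intro s hs
    rcases hs.eq_or_lt with rfl | hs
    · have : j 0 = el (-0) := if_pos le_rfl
      rw [this, el0 _ (by simp), er0 _ le_rfl]
    · exact if_neg hs.not_ge
  have jr : ∀ s ∈ Ico (0 : ℝ) 1, j s ∈ JR ∧ κ (j s) = s := by
    intro s hs
    obtain ⟨h2, h3⟩ := ger s hs
    rw [jr' s hs.1]
    exact ⟨h2, by rw [κr _ (.inr h2), h3]⟩
  refine ⟨κ, j, ⟨?_, ?_, ?_, ?_, ?_, ?_, ?_, ?_⟩, ?_, ?_, ?_, ?_⟩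
  · have h1 : ContinuousOn κ (L ∪ JL) := (glc.neg).congr fun x hx => κl x hx
    have h2 : ContinuousOn κ (R ∪ JR) := grc.congr fun x hx => κr x hx
    have := h1.union_of_isClosed h2 h.left.compactification.1.isClosed
      h.right.compactification.1.isClosed
    rw [h.cover] at this
    exact continuousOn_univ.1 this
  · intro x
    rcases hcov x with (hx | hx) | (hx | hx)
    · rw [vL x hx]; norm_num
    · have := vJL x hx; exact ⟨this.1.le, by linarith⟩
    · rw [vR x hx]; norm_num
    · have := vJR x hx; exact ⟨by linarith, this.2.le⟩
  · refine fun x => ⟨vL x, fun hx => ?_⟩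
    rcases hcov x with (h1 | h1) | (h1 | h1)
    · exact h1
    · linarith [vJL x h1]
    · linarith [vR x h1]
    · linarith [vJR x h1]
  · refine fun x => ⟨vR x, fun hx => ?_⟩
    rcases hcov x with (h1 | h1) | (h1 | h1)
    · linarith [vL x h1]
    · linarith [vJL x h1]
    · exact h1
    · linarith [vJR x h1]
  · rw [continuousOn_iff_continuous_domRestrict]
    refine Continuous.if_le (f := fun s : Ioo (-1 : ℝ) 1 => (s : ℝ)) (g := fun _ => 0)
      (f' := fun s : Ioo (-1 : ℝ) 1 => el (-s)) (g' := fun s : Ioo (-1 : ℝ) 1 => er s)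
      ?_ ?_ (by fun_prop) (by fun_prop) ?_
    · exact elc.comp_continuous (by fun_prop) fun s => by
        have := s.2.1; simp only [mem_Iio]; linarith
    · exact erc.comp_continuous (by fun_prop) fun s => s.2.2
    · intro s hs
      rw [el0 _ (by rw [hs, neg_zero]), er0 _ hs.le]
  · intro s hs
    rcases le_total s 0 with h0 | h0
    · exact (jl s ⟨hs.1, h0⟩).2
    · exact (jr s ⟨h0, hs.2⟩).2
  · intro x hx
    rcases hcov x with (h1 | h1) | (h1 | h1)
    · have := vL x h1; linarith [hx.1]
    · have h2 : j (κ x) = el (-(κ x)) := if_pos (vJL x h1).2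
      rw [h2, κl x (.inr h1), neg_neg, egl x h1]
    · have := vR x h1; linarith [hx.2]
    · rw [jr' _ (vJR x h1).1, κr x (.inr h1), egr x h1]
  · intro x
    have hl : closure JL ⊆ closure (κ ⁻¹' Ioo (-1) 1) := closure_mono fun y hy => by
      have := vJL y hy; exact ⟨this.1, by linarith⟩
    have hr : closure JR ⊆ closure (κ ⁻¹' Ioo (-1) 1) := closure_mono fun y hy => by
      have := vJR y hy; exact ⟨by linarith, this.2⟩
    rcases hcov x with h1 | h1
    · exact hl (h.left.compactification.2.2 h1)
    · exact hr (h.right.compactification.2.2 h1)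
  · ext x
    constructor
    · rintro (hx | hx)
      · have := vL x hx; simp only [mem_preimage, mem_Iic]; linarith
      · exact (vJL x hx).2
    · intro hx
      have hx : κ x ≤ 0 := hx
      rcases hcov x with h1 | (h1 | h1)
      · exact h1
      · linarith [vR x h1]
      · have h2 := (vJR x h1).1
        have h3 : gr x = 0 := by rw [← κr x (.inr h1)]; linarith
        have : x = x₀ := by rw [← egr x h1, h3, er0 _ le_rfl]
        rw [this]; exact .inr hx₀L
  · ext x
    constructor
    · rintro (hx | hx)
      · have := vR x hx; simp only [mem_preimage, mem_Ici]; linarith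
      · exact (vJR x hx).1
    · intro hx
      have hx : 0 ≤ κ x := hx
      rcases hcov x with (h1 | h1) | h1
      · linarith [vL x h1]
      · have h2 := (vJL x h1).2
        have h3 : gl x = 0 := by have := κl x (.inr h1); linarith
        have : x = x₀ := by rw [← egl x h1, h3, el0 _ le_rfl]
        rw [this]; exact .inr hx₀R
      · exact h1
  · ext x
    refine ⟨vJL x, fun hx => ?_⟩
    have h1 := (jl (κ x) hx).1
    rcases hcov x with (h2 | h2) | (h2 | h2)
    · have := vL x h2; linarith [hx.1]
    · exact h2
    · have := vR x h2; linarith [hx.2]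
    · have h3 : gr x = 0 := by rw [← κr x (.inr h2)]; linarith [(vJR x h2).1, hx.2]
      have : x = x₀ := by rw [← egr x h2, h3, er0 _ le_rfl]
      rw [this]; exact hx₀L
  · ext x
    refine ⟨vJR x, fun hx => ?_⟩
    rcases hcov x with (h2 | h2) | (h2 | h2)
    · have := vL x h2; linarith [hx.1]
    · have h3 : gl x = 0 := by have := κl x (.inr h2); linarith [(vJL x h2).2, hx.1]
      have : x = x₀ := by rw [← egl x h2, h3, el0 _ le_rfl]
      rw [this]; exact hx₀R
    · have := vR x h2; linarith [hx.2]
    · exact h2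

end Coordinate

/-! ### Path connected subsets -/

section Paths

variable {X : Type*} [TopologicalSpace X] {L R : Set X} {κ : X → ℝ} {j : ℝ → X}

namespace IsIntervalCoordinate

lemma symm (h : IsIntervalCoordinate L R κ j) :
    IsIntervalCoordinate R L (fun x => -κ x) (fun s => j (-s)) where
  continuous := h.continuous.neg
  mem_Icc x := ⟨by linarith [(h.mem_Icc x).2], by linarith [(h.mem_Icc x).1]⟩
  left x := by rw [h.right, neg_inj]
  right x := by rw [h.left, neg_eq_iff_eq_neg]
  continuousOn_section := h.continuousOn_section.comp continuousOn_neg fun s hs =>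
    ⟨by linarith [hs.2], by linarith [hs.1]⟩
  apply_section s hs := by
    rw [h.apply_section _ ⟨by linarith [hs.2], by linarith [hs.1]⟩, neg_neg]
  section_apply x hx := by
    rw [neg_neg, h.section_apply _ ⟨by linarith [hx.2], by linarith [hx.1]⟩]
  dense := h.dense.mono fun x hx => ⟨by simpa using neg_lt_neg hx.2, by simpa using neg_lt_neg hx.1⟩

lemma trichotomy (h : IsIntervalCoordinate L R κ j) (x : X) :
    κ x ∈ Ioo (-1 : ℝ) 1 ∨ x ∈ L ∨ x ∈ R := by
  rw [h.left, h.right]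
  obtain ⟨h1, h2⟩ := h.mem_Icc x
  rcases h1.eq_or_lt with h1 | h1
  · exact .inr (.inl h1.symm)
  rcases h2.eq_or_lt with h2 | h2
  · exact .inr (.inr h2)
  · exact .inl ⟨h1, h2⟩

/-- A path in the interval cannot end in the remainder: its coordinate tends to the end, so it
passes through points of the interval close to any prescribed point of the remainder. -/
lemma not_path_to_left [T2Space X] (h : IsIntervalCoordinate L R κ j) (hL : L.Nontrivial)
    {γ : ℝ → X} {a b : ℝ} (hab : a < b) (hγ : ContinuousOn γ (Icc a b))
    (hJ : ∀ t ∈ Ico a b, κ (γ t) ∈ Ioo (-1 : ℝ) 1) : γ b ∉ L := by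
  intro hb
  obtain ⟨q, hq, hne⟩ := hL.exists_ne (γ b)
  obtain ⟨U, V, hU, hV, hbU, hqV, hUV⟩ := t2_separation hne.symm
  have h1 : ∀ᶠ t in 𝓝[<] b, γ t ∈ U := by
    have h2 : ContinuousWithinAt γ (Iio b) b :=
      (hγ b (right_mem_Icc.2 hab.le)).mono_of_mem_nhdsWithin
        (Filter.mem_of_superset (Ico_mem_nhdsLT hab) Ico_subset_Icc_self)
    exact h2 (hU.mem_nhds hbU)
  obtain ⟨c, hc, hcU⟩ := mem_nhdsLT_iff_exists_Ico_subset.1 h1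
  set d := max a c with hd
  have hdb : d < b := max_lt hab hc
  have hda : a ≤ d := le_max_left _ _
  have hκd := hJ d ⟨hda, hdb⟩
  obtain ⟨x, ⟨hxV, hxd⟩, hxJ⟩ := h.dense.inter_open_nonempty (V ∩ κ ⁻¹' Iio (κ (γ d)))
    (hV.inter (isOpen_Iio.preimage h.continuous))
    ⟨q, hqV, by have := (h.left q).1 hq; simp only [mem_preimage, this]; exact hκd.1⟩
  have hIVT := intermediate_value_Icc' hdb.le
    ((h.continuous.comp_continuousOn hγ).mono (Icc_subset_Icc_left hda))
  obtain ⟨u, hu, hux⟩ := hIVT ⟨by simp only [Function.comp, (h.left _).1 hb]; exact hxJ.1.le,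
    (le_of_lt hxd : κ x ≤ κ (γ d))⟩
  have hux : κ (γ u) = κ x := hux
  have hub : u ≠ b := by
    rintro rfl
    rw [(h.left _).1 hb] at hux
    exact hxJ.1.ne hux
  have huU : γ u ∈ U := hcU ⟨(le_max_right _ _).trans hu.1, hu.2.lt_of_ne hub⟩
  have : γ u = x := by
    rw [← h.section_apply x hxJ, ← hux, h.section_apply _ (by rw [hux]; exact hxJ)]
  exact hUV.le_bot ⟨huU, this ▸ hxV⟩

/-- The interval is a path component. -/
lemma subset_interval_of_isPathConnected [T2Space X] (h : IsIntervalCoordinate L R κ j)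
    (hL : L.Nontrivial) (hR : R.Nontrivial) {P : Set X} (hP : IsPathConnected P)
    (hPJ : (P ∩ κ ⁻¹' Ioo (-1) 1).Nonempty) : P ⊆ κ ⁻¹' Ioo (-1) 1 := by
  obtain ⟨x, hxP, hxJ⟩ := hPJ
  intro y hy
  by_contra hyJ
  obtain ⟨γ, -⟩ := hP.joinedIn x hxP y hy
  have hγ : Continuous γ.extend := γ.continuous_extend
  have hcl : IsCompact (Icc (0 : ℝ) 1 ∩ γ.extend ⁻¹' (κ ⁻¹' Ioo (-1) 1)ᶜ) :=
    isCompact_Icc.inter_right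
      (((isOpen_Ioo.preimage h.continuous).isClosed_compl).preimage hγ)
  obtain ⟨b, ⟨hbI, hb⟩, hmin⟩ := hcl.exists_isLeast
    ⟨1, right_mem_Icc.2 zero_le_one, by simpa using hyJ⟩
  have hb0 : 0 < b := by
    refine hbI.1.lt_of_ne ?_
    rintro rfl
    exact hb (by simpa using hxJ)
  have hJ : ∀ t ∈ Ico 0 b, κ (γ.extend t) ∈ Ioo (-1 : ℝ) 1 := by
    intro t ht
    by_contra hc
    exact absurd (hmin ⟨⟨ht.1, ht.2.le.trans hbI.2⟩, hc⟩) (not_le.2 ht.2)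
  rcases h.trichotomy (γ.extend b) with h1 | h1 | h1
  · exact hb h1
  · exact h.not_path_to_left hL hb0 hγ.continuousOn hJ h1
  · exact h.symm.not_path_to_left hR hb0 hγ.continuousOn
      (fun t ht => ⟨by linarith [(hJ t ht).2], by linarith [(hJ t ht).1]⟩) h1

/-- The path components are the interval and, as long as they are path connected, the two
remainders. -/
lemma subset_of_isPathConnected [T2Space X] (h : IsIntervalCoordinate L R κ j)
    (hL : L.Nontrivial) (hR : R.Nontrivial) {P : Set X} (hP : IsPathConnected P) :
    P ⊆ κ ⁻¹' Ioo (-1) 1 ∨ P ⊆ L ∨ P ⊆ R := by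
  by_cases hJ : (P ∩ κ ⁻¹' Ioo (-1) 1).Nonempty
  · exact .inl (h.subset_interval_of_isPathConnected hL hR hP hJ)
  right
  have hPLR : ∀ x ∈ P, x ∈ L ∨ x ∈ R := fun x hx =>
    (h.trichotomy x).resolve_left fun hc => hJ ⟨x, hx, hc⟩
  -- the coordinate maps `P` to a connected subset of `{-1, 1}`
  by_contra! hc
  obtain ⟨⟨x, hx, hxL⟩, y, hy, hyR⟩ := And.imp not_subset.1 not_subset.1 hc
  have hxR := (hPLR x hx).resolve_left hxL
  have hyL := (hPLR y hy).resolve_right hyR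
  have h1 := hP.isConnected.isPreconnected.intermediate_value hy hx h.continuous.continuousOn
  rw [(h.left y).1 hyL, (h.right x).1 hxR] at h1
  obtain ⟨z, hz, hz0⟩ := h1 (show (0 : ℝ) ∈ Icc (-1) 1 by norm_num)
  exact hJ ⟨z, hz, by simp [hz0]⟩

lemma isPathConnected_section_image (h : IsIntervalCoordinate L R κ j) {s : Set ℝ}
    (hs : Convex ℝ s) (hne : s.Nonempty) (hsub : s ⊆ Ioo (-1) 1) : IsPathConnected (j '' s) :=
  (hs.isPathConnected hne).image' (h.continuousOn_section.mono hsub)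

lemma section_image_eq (h : IsIntervalCoordinate L R κ j) {s : Set ℝ} (hsub : s ⊆ Ioo (-1) 1) :
    j '' s = κ ⁻¹' s := by
  ext x
  constructor
  · rintro ⟨t, ht, rfl⟩
    simpa [h.apply_section t (hsub ht)] using ht
  · exact fun hx => ⟨κ x, hx, h.section_apply x (hsub hx)⟩

lemma isPathConnected_preimage (h : IsIntervalCoordinate L R κ j) {s : Set ℝ}
    (hs : Convex ℝ s) (hne : s.Nonempty) (hsub : s ⊆ Ioo (-1) 1) : IsPathConnected (κ ⁻¹' s) :=
  h.section_image_eq hsub ▸ h.isPathConnected_section_image hs hne hsub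

end IsIntervalCoordinate

lemma DenseFreeInterval.IsArc.isPathConnected {A : Set X} (h : IsArc A) : IsPathConnected A := by
  obtain ⟨h⟩ := h
  have : PathConnectedSpace (Icc (0 : ℝ) 1) := isPathConnected_iff_pathConnectedSpace.1
    ((convex_Icc (0 : ℝ) 1).isPathConnected ⟨0, by simp⟩)
  have h2 := isPathConnected_range (continuous_subtype_val.comp h.symm.continuous)
  rwa [range_comp, h.symm.range_coe, image_univ, Subtype.range_coe] at h2

lemma DenseFreeInterval.IsArc.nontrivial {A : Set X} (h : IsArc A) : A.Nontrivial := by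
  obtain ⟨h⟩ := h
  refine ⟨h.symm ⟨0, by simp⟩, Subtype.coe_prop _, h.symm ⟨1, by simp⟩, Subtype.coe_prop _, ?_⟩
  simp [Subtype.coe_inj]

lemma DenseFreeInterval.IsArc.locallyConnectedSpace {A : Set X} (h : IsArc A) : LocallyConnectedSpace A := by
  obtain ⟨h⟩ := h
  have : LocallyConnectedSpace (Icc (0 : ℝ) 1) :=
    (isQuotientMap_projIcc (h := zero_le_one)).isCoinducing.locallyConnectedSpace
  exact h.locallyConnectedSpace

end Paths

/-! ### Membership in the class of continua with a dense free interval -/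

section ClassC

variable {X : Type*} [TopologicalSpace X]

lemma IsIntervalCoordinate.isFreeInterval {L R : Set X} {κ : X → ℝ} {j : ℝ → X}
    (h : IsIntervalCoordinate L R κ j) : IsFreeInterval (κ ⁻¹' Ioo (-1) 1) := by
  refine ⟨isOpen_Ioo.preimage h.continuous, ⟨?_⟩⟩
  exact
  { toFun := fun x => ⟨(κ x + 1) / 2, by have := x.2.1; linarith, by have := x.2.2; linarith⟩
    invFun := fun s => ⟨j (2 * s - 1), by
      have h1 := s.2.1
      have h2 := s.2.2
      rw [mem_preimage, h.apply_section _ ⟨by linarith, by linarith⟩]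
      exact ⟨by linarith, by linarith⟩⟩
    left_inv := fun x => Subtype.ext <| by
      have : 2 * ((κ x + 1) / 2) - 1 = κ x := by ring
      simp only [this]
      exact h.section_apply x x.2
    right_inv := fun s => Subtype.ext <| by
      have h1 := s.2.1
      have h2 := s.2.2
      simp only [h.apply_section (2 * s - 1) ⟨by linarith, by linarith⟩]
      ring
    continuous_toFun := Continuous.subtype_mk
      (((h.continuous.comp continuous_subtype_val).add continuous_const).div_const 2) _
    continuous_invFun := Continuous.subtype_mk
      (h.continuousOn_section.comp_continuous (by fun_prop) fun s => by
        have h1 := s.2.1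
        have h2 := s.2.2
        exact ⟨by linarith, by linarith⟩) fun s => by
      have h1 := s.2.1
      have h2 := s.2.2
      simp only [Function.comp_apply, mem_preimage]
      rw [h.apply_section _ ⟨by linarith, by linarith⟩]
      exact ⟨by linarith, by linarith⟩ }

lemma IsIntervalCoordinate.isNowhereDense_left {L R : Set X} {κ : X → ℝ} {j : ℝ → X}
    (h : IsIntervalCoordinate L R κ j) : IsNowhereDense L := by
  have hL : L = κ ⁻¹' {-1} := ext h.left
  have hcl : IsClosed L := hL ▸ isClosed_singleton.preimage h.continuous
  rw [hcl.isNowhereDense_iff, ← not_nonempty_iff_eq_empty]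
  intro hne
  obtain ⟨x, hx, hxJ⟩ := h.dense.inter_open_nonempty _ isOpen_interior hne
  exact hxJ.1.ne ((h.left x).1 (interior_subset hx)).symm

lemma DenseFreeInterval.IsGluingOfRayCompactifications.isInClassC {L JL JR R : Set X} {x₀ : X}
    (h : IsGluingOfRayCompactifications L JL JR R x₀) : IsInClassC L (JL ∪ JR) R := by
  obtain ⟨κ, j, hκ, -, -, hJL, hJR⟩ := exists_intervalCoordinate h
  have hJ : JL ∪ JR = κ ⁻¹' Ioo (-1) 1 := by
    rw [hJL, hJR, ← preimage_union, Ioc_union_Ico_eq_Ioo (by norm_num) (by norm_num)]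
  have hconn : IsPathConnected (κ ⁻¹' Ioo (-1) 1) :=
    hκ.isPathConnected_preimage (convex_Ioo _ _) ⟨0, by norm_num⟩ le_rfl
  refine
  { metrizable := h.metrizable
    compact := ⟨by
      rw [← h.cover]; exact h.left.compactification.1.union h.right.compactification.1⟩
    connected := by
      rw [connectedSpace_iff_univ, ← hκ.dense.closure_eq]
      exact hconn.isConnected.closure
    cover := by rw [← h.cover]; ac_rfl
    freeInterval := hJ ▸ hκ.isFreeInterval
    dense := hJ ▸ hκ.dense
    left_continuum := ⟨h.left.arc.isCompact, h.left.arc.isPathConnected.isConnected,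
      h.left.arc.locallyConnectedSpace⟩
    right_continuum := ⟨h.right.arc.isCompact, h.right.arc.isPathConnected.isConnected,
      h.right.arc.locallyConnectedSpace⟩
    left_nowhereDense := hκ.isNowhereDense_left
    right_nowhereDense := hκ.symm.isNowhereDense_left
    left_disjoint := ?_
    right_disjoint := ?_
    exists_rays := ?_ }
  · rw [hJ, Set.disjoint_left]
    intro x hx hxJ
    exact hxJ.1.ne ((hκ.left x).1 hx).symm
  · rw [hJ, Set.disjoint_left]
    intro x hx hxJ
    exact hxJ.2.ne ((hκ.right x).1 hx)
  · obtain ⟨hl, -, -⟩ := h.left.ray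
    obtain ⟨hr, -, -⟩ := h.right.ray
    exact ⟨JL, JR, ⟨hl⟩, ⟨hr⟩, rfl, h.left.compactification, h.right.compactification⟩

end ClassC

/-! ### Minimal sets of subspaces -/

section MinimalSets

variable {X : Type*} [TopologicalSpace X]

lemma DenseFreeInterval.IsMinimalSetOf.congr {f g : X → X} {M : Set X} (h : IsMinimalSetOf f M)
    (hfg : EqOn f g M) : IsMinimalSetOf g M := by
  obtain ⟨h1, h2, h3, h4⟩ := h
  refine ⟨h1, h2, by rw [← hfg.image_eq, h3], fun N hNM hN hNcl hgN => h4 N hNM hN hNcl ?_⟩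
  rwa [(hfg.mono hNM).image_eq]

/-- If every compact subset of `Y` is fixed pointwise by some continuous map of the whole space
into `Y`, then self-maps of `Y` and of the whole space have the same minimal sets inside `Y`:
pre- or postcompose with such a map. -/
lemma mem_minimalSets_iff_of_subset {Y M : Set X} (hMY : M ⊆ Y)
    (hr : IsCompact M → ∃ r : X → X, Continuous r ∧ (∀ x, r x ∈ Y) ∧ EqOn r id M) :
    M ∈ minimalSets Y ↔ M ∈ minimalSets (univ : Set X) := by
  constructor
  · rintro ⟨-, f, hf, -, hM⟩
    obtain ⟨r, hrc, hrY, hrM⟩ := hr hM.2.1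
    refine ⟨subset_univ _, f ∘ r, (hf.comp_continuous hrc hrY).continuousOn, mapsTo_univ _ _,
      hM.congr fun x hx => ?_⟩
    simp [hrM hx]
  · rintro ⟨-, f, hf, -, hM⟩
    obtain ⟨r, hrc, hrY, hrM⟩ := hr hM.2.1
    refine ⟨hMY, r ∘ f, hrc.comp_continuousOn (hf.mono (subset_univ _)), fun x _ => hrY _,
      hM.congr fun x hx => ?_⟩
    have : f x ∈ M := hM.2.2.1 ▸ mem_image_of_mem f hx
    simp [hrM this]

/-- By the Tietze extension theorem, an arc in a normal Hausdorff space is a retract. -/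
lemma DenseFreeInterval.IsArc.exists_retraction [T2Space X] [NormalSpace X] {A : Set X}
    (hA : IsArc A) : ∃ r : X → X, Continuous r ∧ (∀ x, r x ∈ A) ∧ EqOn r id A := by
  have hcl := hA.isCompact.isClosed
  obtain ⟨h⟩ := hA
  have : TietzeExtension (Icc (0 : ℝ) 1) :=
    .of_retract ⟨Subtype.val, continuous_subtype_val⟩ ⟨projIcc 0 1 zero_le_one, continuous_projIcc⟩
      (by ext x; simp)
  obtain ⟨g, hg⟩ := ContinuousMap.exists_restrict_eq hcl (⟨h, h.continuous⟩ : C(A, Icc (0 : ℝ) 1))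
  refine ⟨fun x => h.symm (g x), continuous_subtype_val.comp (h.symm.continuous.comp g.continuous),
    fun x => Subtype.coe_prop _, fun x hx => ?_⟩
  have : g x = h ⟨x, hx⟩ := DFunLike.congr_fun hg (⟨x, hx⟩ : A)
  simp [this]

namespace IsIntervalCoordinate

variable {L R : Set X} {κ : X → ℝ} {j : ℝ → X}

/-- Clamping the coordinate retracts the space onto a compact part of the interval. -/
lemma exists_retraction_of_subset_interval (h : IsIntervalCoordinate L R κ j) {M : Set X}
    (hM : IsCompact M) (hMJ : M ⊆ κ ⁻¹' Ioo (-1) 1) :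
    ∃ r : X → X, Continuous r ∧ (∀ x, r x ∈ κ ⁻¹' Ioo (-1) 1) ∧ EqOn r id M := by
  obtain ⟨a, b, ha, hab, hb, hMab⟩ : ∃ a b : ℝ, -1 < a ∧ a ≤ b ∧ b < 1 ∧ M ⊆ κ ⁻¹' Icc a b := by
    rcases M.eq_empty_or_nonempty with rfl | hne
    · exact ⟨0, 0, by norm_num, le_rfl, by norm_num, empty_subset _⟩
    obtain ⟨x, hx, hxm⟩ := hM.exists_isMinOn hne h.continuous.continuousOn
    obtain ⟨y, hy, hym⟩ := hM.exists_isMaxOn hne h.continuous.continuousOn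
    exact ⟨κ x, κ y, (hMJ hx).1, hxm hy, (hMJ hy).2, fun z hz => ⟨hxm hz, hym hz⟩⟩
  have hmem : ∀ s, max a (min b s) ∈ Ioo (-1 : ℝ) 1 := fun s =>
    ⟨ha.trans_le (le_max_left _ _), (max_le hab (min_le_left _ _)).trans_lt hb⟩
  refine ⟨fun x => j (max a (min b (κ x))), ?_, fun x => ?_, fun x hx => ?_⟩
  · have := h.continuous
    exact h.continuousOn_section.comp_continuous (by fun_prop) fun x => hmem _
  · rw [mem_preimage, h.apply_section _ (hmem _)]; exact hmem _
  · obtain ⟨h1, h2⟩ := hMab hx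
    have h3 : max a (min b (κ x)) = κ x := by rw [min_eq_right h2, max_eq_right h1]
    simp only [h3, id]
    exact h.section_apply x (hMJ hx)

/-! ### No map exchanging the remainders -/

/-- Stretching an initial part of the interval: a map of the space onto `κ ≤ 0` which fixes all
points near `L` and maps `κ ≤ c` onto `κ ≤ 0`. -/
lemma exists_stretch (h : IsIntervalCoordinate L R κ j) {c : ℝ} (hc : -1 < c) (hc0 : c < 0) :
    ∃ S : X → X, Continuous S ∧ (∀ x, κ (S x) ≤ 0) ∧
      ∀ y, κ y ≤ 0 → ∃ x, κ x ≤ c ∧ S x = y := by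
  classical
  -- the affine map `ℓ` stretches `[d, c]` to `[d, 0]`, where `d` is the midpoint of `[-1, c]`
  set d := (c - 1) / 2 with hd
  have hd1 : -1 < d := by linarith
  have hdc : 0 < c - d := by linarith
  have hd0 : d < 0 := by linarith
  set ℓ : ℝ → ℝ := fun s => d + (s - d) * (-d / (c - d)) with hℓ
  have hmem : ∀ s, max d (min 0 s) ∈ Ioo (-1 : ℝ) 1 := fun s =>
    ⟨hd1.trans_le (le_max_left _ _), (max_le hd0.le (min_le_left _ _)).trans_lt one_pos⟩
  have hκ := h.continuous
  refine ⟨fun x => if κ x ≤ d then x else j (max d (min 0 (ℓ (κ x)))), ?_, ?_, ?_⟩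
  · refine Continuous.if_le continuous_id ?_ hκ continuous_const ?_
    · exact h.continuousOn_section.comp_continuous (by fun_prop) fun x => hmem _
    · intro x hx
      have h1 : max d (min 0 (ℓ (κ x))) = κ x := by
        simp only [hℓ, hx, sub_self, zero_mul, add_zero]
        rw [min_eq_right hd0.le, max_self]
      rw [h1, h.section_apply x (by rw [hx]; exact ⟨hd1, by linarith⟩)]
  · intro x
    beta_reduce
    split_ifs with hx
    · linarith
    · rw [h.apply_section _ (hmem _)]
      exact max_le hd0.le (min_le_left _ _)
  · intro y hy
    by_cases hyd : κ y ≤ d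
    · exact ⟨y, by linarith, if_pos hyd⟩
    push Not at hyd
    set s := d + (κ y - d) * ((c - d) / -d) with hs
    have hsd : d < s := by
      have : 0 < (κ y - d) * ((c - d) / -d) :=
        mul_pos (by linarith) (div_pos hdc (by linarith))
      linarith
    have hsc : s ≤ c := by
      have h1 : (κ y - d) * ((c - d) / -d) ≤ -d * ((c - d) / -d) :=
        mul_le_mul_of_nonneg_right (by linarith) (div_nonneg hdc.le (by linarith))
      have h2 : -d * ((c - d) / -d) = c - d := mul_div_cancel₀ _ (by linarith)
      linarith
    have hℓs : ℓ s = κ y := by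
      have h1 : d ≠ 0 := hd0.ne
      have h2 : c - d ≠ 0 := hdc.ne'
      simp only [hℓ, hs]
      field_simp
      ring
    have hsI : s ∈ Ioo (-1 : ℝ) 1 := ⟨by linarith, by linarith⟩
    refine ⟨j s, by rw [h.apply_section s hsI]; exact hsc, ?_⟩
    simp only [h.apply_section s hsI]
    rw [if_neg (not_le.2 hsd), hℓs, min_eq_right hy, max_eq_right hyd.le,
      h.section_apply y ⟨by linarith, by linarith⟩]

/-- If a continuous map keeps the interval invariant and maps `R` into `L`, then it reverses the
ends of the interval, so that the image of the right half of the space contains a neighborhood of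
`L`; stretching it gives all of the left half. -/
lemma mapsContinuouslyOnto_of_image_right [CompactSpace X] [T2Space X]
    (h : IsIntervalCoordinate L R κ j) (hR : R.Nonempty) {f : X → X}
    (hf : Continuous f) (hJ : MapsTo f (κ ⁻¹' Ioo (-1) 1) (κ ⁻¹' Ioo (-1) 1))
    (hRL : MapsTo f R L) : MapsContinuouslyOnto (κ ⁻¹' Ici 0) (κ ⁻¹' Iic 0) := by
  have h0 : (0 : ℝ) ∈ Ioo (-1 : ℝ) 1 := by norm_num
  obtain ⟨p, hp⟩ := hR
  have hpκ := (h.right p).1 hp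
  set x₀ := j 0
  have hx₀ : κ x₀ = 0 := h.apply_section 0 h0
  have hfx₀ : κ (f x₀) ∈ Ioo (-1 : ℝ) 1 := hJ (by rw [mem_preimage, hx₀]; exact h0)
  -- the right half is the closure of the right half of the interval, hence connected
  have hconn : IsPreconnected (κ ⁻¹' Ici 0) := by
    have h1 : IsConnected (κ ⁻¹' Ico 0 1) :=
      (h.isPathConnected_preimage (convex_Ico _ _) ⟨0, by norm_num⟩
        fun s hs => ⟨by linarith [hs.1], hs.2⟩).isConnected
    refine h1.isPreconnected.subset_closure (preimage_mono Ico_subset_Ici_self) fun x hx => ?_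
    rcases (h.mem_Icc x).2.eq_or_lt with hx1 | hx1
    · rw [mem_closure_iff]
      intro U hU hxU
      obtain ⟨y, ⟨hyU, hy0⟩, hyJ⟩ := h.dense.inter_open_nonempty (U ∩ κ ⁻¹' Ioi 0)
        (hU.inter (isOpen_Ioi.preimage h.continuous)) ⟨x, hxU, by simp [hx1]⟩
      exact ⟨y, hyU, le_of_lt hy0, hyJ.2⟩
    · exact subset_closure ⟨hx, hx1⟩
  obtain ⟨c, hc, hc0, hcx⟩ : ∃ c : ℝ, -1 < c ∧ c < 0 ∧ c ≤ κ (f x₀) :=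
    ⟨min (-1 / 2) (κ (f x₀)), lt_min (by norm_num) hfx₀.1,
      (min_le_left _ _).trans_lt (by norm_num), min_le_right _ _⟩
  have hIVT := hconn.intermediate_value (show p ∈ κ ⁻¹' Ici 0 by simp [hpκ])
    (show x₀ ∈ κ ⁻¹' Ici 0 by simp [hx₀]) (h.continuous.comp hf).continuousOn
  have himJ : ∀ y, κ y ∈ Ioc (-1) c → y ∈ f '' (κ ⁻¹' Ici 0) := by
    intro y hy
    obtain ⟨x, hx, hxy⟩ := hIVT ⟨by
      simp only [Function.comp, (h.left _).1 (hRL hp)]; exact hy.1.le, hy.2.trans hcx⟩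
    have hyI : κ y ∈ Ioo (-1 : ℝ) 1 := ⟨hy.1, by linarith [hy.2]⟩
    have hxy : κ (f x) = κ y := hxy
    exact ⟨x, hx, by rw [← h.section_apply y hyI, ← hxy, h.section_apply _ (hxy ▸ hyI)]⟩
  have himcl : IsClosed (f '' (κ ⁻¹' Ici 0)) :=
    ((isClosed_Ici.preimage h.continuous).isCompact.image hf).isClosed
  have him : ∀ y, κ y ≤ c → y ∈ f '' (κ ⁻¹' Ici 0) := by
    intro y hy
    rcases (h.mem_Icc y).1.eq_or_lt with hy1 | hy1
    · rw [← himcl.closure_eq, mem_closure_iff]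
      intro U hU hyU
      obtain ⟨z, ⟨hzU, hzc⟩, hzJ⟩ := h.dense.inter_open_nonempty (U ∩ κ ⁻¹' Iio c)
        (hU.inter (isOpen_Iio.preimage h.continuous)) ⟨y, hyU, by
          simp only [mem_preimage, mem_Iio]; linarith⟩
      exact ⟨z, hzU, himJ z ⟨hzJ.1, le_of_lt hzc⟩⟩
    · exact himJ y ⟨hy1, hy⟩
  obtain ⟨S, hS, hS0, hSsurj⟩ := h.exists_stretch hc hc0
  refine ⟨S ∘ f, (hS.comp hf).continuousOn, Subset.antisymm ?_ fun y hy => ?_⟩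
  · rintro _ ⟨x, -, rfl⟩
    exact hS0 _
  · obtain ⟨z, hz, rfl⟩ := hSsurj y hy
    obtain ⟨x, hx, rfl⟩ := him z hz
    exact ⟨x, hx, rfl⟩

/-- A minimal set that meets `L` lies in `L`: some point `x` of it is mapped into `L`, and if `x`
lies in `R` instead of `L`, then `R` is mapped into `L`, which is excluded. -/
lemma minimalSet_subset_left [CompactSpace X] [T2Space X]
    (h : IsIntervalCoordinate L R κ j) (hL : IsArc L) (hR : IsArc R)
    (hRL : ¬ MapsContinuouslyOnto (κ ⁻¹' Ici 0) (κ ⁻¹' Iic 0)) {f : X → X} (hf : Continuous f)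
    (hJ : MapsTo f (κ ⁻¹' Ioo (-1) 1) (κ ⁻¹' Ioo (-1) 1)) {M : Set X} (hM : IsMinimalSetOf f M)
    (hML : (M ∩ L).Nonempty) : M ⊆ L := by
  have disj : ∀ {x}, x ∈ L → x ∉ R ∧ κ x ∉ Ioo (-1 : ℝ) 1 := fun {x} hx => by
    rw [h.left] at hx
    rw [h.right, hx]
    norm_num
  obtain ⟨y, hyM, hyL⟩ := hML
  obtain ⟨x, hxM, rfl⟩ := hM.2.2.1.symm ▸ hyM
  have key : ∀ {P : Set X}, IsPathConnected P → x ∈ P → MapsTo f P L := by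
    intro P hP hxP
    have hfx := mem_image_of_mem f hxP
    rcases h.subset_of_isPathConnected hL.nontrivial hR.nontrivial (hP.image hf) with h1 | h1 | h1
    · exact absurd (h1 hfx) (disj hyL).2
    · exact mapsTo_iff_image_subset.2 h1
    · exact absurd (h1 hfx) (disj hyL).1
  rcases h.trichotomy x with hx | hx | hx
  · exact absurd (hJ hx) (disj hyL).2
  · have hLL := key hL.isPathConnected hx
    have := hM.2.2.2 (M ∩ L) inter_subset_left ⟨x, hxM, hx⟩
      (hM.2.1.isClosed.inter hL.isCompact.isClosed) (by
        rintro _ ⟨z, ⟨hzM, hzL⟩, rfl⟩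
        exact ⟨hM.2.2.1 ▸ mem_image_of_mem f hzM, hLL hzL⟩)
    exact inter_eq_left.1 this
  · exact absurd (h.mapsContinuouslyOnto_of_image_right hR.nontrivial.nonempty hf hJ
      (key hR.isPathConnected hx)) hRL

lemma minimalSet_subset [CompactSpace X] [T2Space X]
    (h : IsIntervalCoordinate L R κ j) (hL : IsArc L) (hR : IsArc R)
    (hLR : ¬ MapsContinuouslyOnto (κ ⁻¹' Iic 0) (κ ⁻¹' Ici 0))
    (hRL : ¬ MapsContinuouslyOnto (κ ⁻¹' Ici 0) (κ ⁻¹' Iic 0)) {M : Set X}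
    (hM : M ∈ minimalSets (univ : Set X)) :
    M ⊆ κ ⁻¹' Ioo (-1) 1 ∨ M ⊆ L ∨ M ⊆ R := by
  obtain ⟨-, f, hf, -, hM⟩ := hM
  rw [continuousOn_univ] at hf
  have hconn : IsPathConnected (κ ⁻¹' Ioo (-1) 1) :=
    h.isPathConnected_preimage (convex_Ioo _ _) ⟨0, by norm_num⟩ le_rfl
  have hrange : ∀ {A : Set X}, IsClosed A → f '' (κ ⁻¹' Ioo (-1) 1) ⊆ A → M ⊆ A := by
    intro A hA hfA x hx
    obtain ⟨y, -, rfl⟩ := hM.2.2.1.symm ▸ hx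
    have h1 := image_closure_subset_closure_image hf (s := κ ⁻¹' Ioo (-1) 1)
    rw [h.dense.closure_eq] at h1
    exact closure_minimal hfA hA (h1 (mem_image_of_mem f (mem_univ y)))
  rcases h.subset_of_isPathConnected hL.nontrivial hR.nontrivial (hconn.image hf)
    with h1 | h1 | h1
  · rw [← mapsTo_iff_image_subset] at h1
    by_cases hML : (M ∩ L).Nonempty
    · exact .inr (.inl (h.minimalSet_subset_left hL hR hRL hf h1 hM hML))
    by_cases hMR : (M ∩ R).Nonempty
    · refine .inr (.inr (h.symm.minimalSet_subset_left hR hL ?_ hf ?_ hM hMR))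
      · convert hLR using 2 <;> ext x <;> simp
      · intro x hx
        have := @h1 x ⟨by linarith [hx.2], by linarith [hx.1]⟩
        exact ⟨by linarith [this.2], by linarith [this.1]⟩
    · refine .inl fun x hx => ?_
      rcases h.trichotomy x with h2 | h2 | h2
      · exact h2
      · exact absurd ⟨x, hx, h2⟩ hML
      · exact absurd ⟨x, hx, h2⟩ hMR
  · exact .inr (.inl (hrange hL.isCompact.isClosed h1))
  · exact .inr (.inr (hrange hR.isCompact.isClosed h1))

end IsIntervalCoordinate

lemma disjoint_minimalSets {Y Z : Set X} (h : Disjoint Y Z) :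
    Disjoint (minimalSets Y) (minimalSets Z) := by
  rw [Set.disjoint_left]
  rintro M ⟨hY, -, -, -, ⟨x, hx⟩, -⟩ ⟨hZ, -⟩
  exact h.le_bot ⟨hY hx, hZ hx⟩

/-- Minimal sets on a gluing of two ray compactifications neither of which maps onto the other. -/
theorem minimalSets_of_gluing {L JL JR R : Set X} {x₀ : X}
    (h : IsGluingOfRayCompactifications L JL JR R x₀)
    (hLR : ¬ MapsContinuouslyOnto (L ∪ JL) (R ∪ JR))
    (hRL : ¬ MapsContinuouslyOnto (R ∪ JR) (L ∪ JL)) :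
    Disjoint L R ∧
      minimalSets (univ : Set X) = minimalSets (JL ∪ JR) ∪ minimalSets L ∪ minimalSets R ∧
      Disjoint (minimalSets (JL ∪ JR)) (minimalSets L) ∧
      Disjoint (minimalSets (JL ∪ JR)) (minimalSets R) ∧
      Disjoint (minimalSets L) (minimalSets R) ∧
      ∀ M ∈ minimalSets (univ : Set X), ¬ ((M ∩ L).Nonempty ∧ (M ∩ R).Nonempty) := by
  have := h.metrizable
  have hC := h.isInClassC
  have := hC.compact
  obtain ⟨κ, j, hκ, hl, hr, hJL, hJR⟩ := exists_intervalCoordinate h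
  have hJ : JL ∪ JR = κ ⁻¹' Ioo (-1) 1 := by
    rw [hJL, hJR, ← preimage_union, Ioc_union_Ico_eq_Ioo (by norm_num) (by norm_num)]
  rw [hl, hr] at hLR hRL
  have hd : Disjoint L R := by
    rw [Set.disjoint_left]
    intro x hx
    rw [hκ.left] at hx
    rw [hκ.right, hx]
    norm_num
  have hsub : ∀ M ∈ minimalSets (univ : Set X), M ⊆ JL ∪ JR ∨ M ⊆ L ∨ M ⊆ R := by
    rw [hJ]
    exact fun M => hκ.minimalSet_subset h.left.arc h.right.arc hLR hRL
  have iJ : ∀ {M}, M ⊆ JL ∪ JR → (M ∈ minimalSets (JL ∪ JR) ↔ M ∈ minimalSets (univ : Set X)) := by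
    rw [hJ]
    exact fun hM => mem_minimalSets_iff_of_subset hM fun hc =>
      hκ.exists_retraction_of_subset_interval hc hM
  have iA : ∀ {A : Set X}, IsArc A → ∀ {M}, M ⊆ A →
      (M ∈ minimalSets A ↔ M ∈ minimalSets (univ : Set X)) := by
    intro A hA M hM
    obtain ⟨r, h1, h2, h3⟩ := hA.exists_retraction
    exact mem_minimalSets_iff_of_subset hM fun _ => ⟨r, h1, h2, h3.mono hM⟩
  refine ⟨hd, ?_, disjoint_minimalSets hC.left_disjoint.symm,
    disjoint_minimalSets hC.right_disjoint.symm, disjoint_minimalSets hd, ?_⟩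
  · ext M
    constructor
    · intro hM
      rcases hsub M hM with h1 | h1 | h1
      · exact .inl (.inl ((iJ h1).2 hM))
      · exact .inl (.inr ((iA h.left.arc h1).2 hM))
      · exact .inr ((iA h.right.arc h1).2 hM)
    · rintro ((hM | hM) | hM)
      · exact (iJ hM.1).1 hM
      · exact (iA h.left.arc hM.1).1 hM
      · exact (iA h.right.arc hM.1).1 hM
  · rintro M hM ⟨⟨x, hx, hxL⟩, y, hy, hyR⟩
    rcases hsub M hM with h1 | h1 | h1
    · exact hC.left_disjoint.le_bot ⟨hxL, h1 hx⟩
    · exact hd.le_bot ⟨h1 hy, hyR⟩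
    · exact hd.le_bot ⟨hxL, h1 hx⟩

end MinimalSets

/-! ### Piecewise linear interpolation -/

section Interpolation

/-- The function on `[0, ∞)` that interpolates the sequence `V` linearly between consecutive
natural numbers. -/
noncomputable def linearInterpolation (V : ℕ → ℝ) (t : ℝ) : ℝ :=
  V ⌊t⌋₊ + (t - ⌊t⌋₊) * (V (⌊t⌋₊ + 1) - V ⌊t⌋₊)

variable {V : ℕ → ℝ}

lemma linearInterpolation_natCast (n : ℕ) : linearInterpolation V n = V n := by
  simp [linearInterpolation]

lemma linearInterpolation_eq {n : ℕ} {t : ℝ} (ht : t ∈ Icc (n : ℝ) (n + 1)) :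
    linearInterpolation V t = V n + (t - n) * (V (n + 1) - V n) := by
  rcases ht.2.eq_or_lt with h | h
  · have h1 : t = ((n + 1 : ℕ) : ℝ) := by push_cast; exact h
    have h2 : t - n = 1 := by rw [h]; ring
    rw [h2, h1, linearInterpolation_natCast]; ring
  · have : ⌊t⌋₊ = n := (Nat.floor_eq_iff (n.cast_nonneg.trans ht.1)).2 ⟨ht.1, h⟩
    rw [linearInterpolation, this]

lemma linearInterpolation_mem_Icc {a b : ℕ} {lo hi t : ℝ}
    (hV : ∀ n, a ≤ n → n ≤ b → V n ∈ Icc lo hi) (ht : t ∈ Icc (a : ℝ) b) :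
    linearInterpolation V t ∈ Icc lo hi := by
  have hab : a ≤ b := by exact_mod_cast ht.1.trans ht.2
  rcases ht.2.eq_or_lt with h | h
  · rw [h, linearInterpolation_natCast]; exact hV b hab le_rfl
  have ht0 : 0 ≤ t := a.cast_nonneg.trans ht.1
  have h1 : a ≤ ⌊t⌋₊ := Nat.le_floor ht.1
  have h2 : ⌊t⌋₊ < b := (Nat.floor_lt ht0).2 h
  have h3 := (convex_Icc lo hi) (hV _ h1 h2.le) (hV (⌊t⌋₊ + 1) (by omega) h2)
    (a := 1 - (t - ⌊t⌋₊)) (b := t - ⌊t⌋₊) (by linarith [Nat.lt_floor_add_one t])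
    (by linarith [Nat.floor_le ht0]) (by ring)
  convert h3 using 1
  simp only [linearInterpolation, smul_eq_mul]
  ring

lemma abs_linearInterpolation_sub_le {C s t : ℝ} (hV : ∀ n, V n ∈ Icc 0 C) (hs : 0 ≤ s)
    (hst : s ≤ t) : |linearInterpolation V t - linearInterpolation V s| ≤ C * (t - s) := by
  have hC : ∀ m n, |V m - V n| ≤ C := fun m n => by
    have h1 := hV m
    have h2 := hV n
    rw [abs_le]; constructor <;> linarith [h1.1, h1.2, h2.1, h2.2]
  have hC0 : 0 ≤ C := (hV 0).1.trans (hV 0).2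
  have step : ∀ (n : ℕ) (x y : ℝ), (n : ℝ) ≤ x → x ≤ y → y ≤ n + 1 →
      |linearInterpolation V y - linearInterpolation V x| ≤ C * (y - x) := by
    intro n x y h1 h2 h3
    rw [linearInterpolation_eq ⟨h1.trans h2, h3⟩, linearInterpolation_eq ⟨h1, h2.trans h3⟩]
    have : V n + (y - n) * (V (n + 1) - V n) - (V n + (x - n) * (V (n + 1) - V n)) =
      (V (n + 1) - V n) * (y - x) := by ring
    rw [this, abs_mul, abs_of_nonneg (sub_nonneg.2 h2)]
    exact mul_le_mul_of_nonneg_right (hC _ _) (sub_nonneg.2 h2)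
  have hs1 := Nat.floor_le hs
  have hs2 := (Nat.lt_floor_add_one s).le
  have ht1 := Nat.floor_le (hs.trans hst)
  have ht2 := (Nat.lt_floor_add_one t).le
  have hfl : ⌊s⌋₊ ≤ ⌊t⌋₊ := Nat.floor_mono hst
  rcases hfl.eq_or_lt with h | h
  · exact step ⌊s⌋₊ s t hs1 hst (h ▸ ht2)
  · have a1 := step ⌊s⌋₊ s (⌊s⌋₊ + 1) hs1 hs2 le_rfl
    have a2 := step ⌊t⌋₊ ⌊t⌋₊ t le_rfl ht1 ht2
    have hle : ((⌊s⌋₊ : ℝ) + 1) ≤ ⌊t⌋₊ := by exact_mod_cast h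
    have a3 : |linearInterpolation V (⌊t⌋₊ : ℝ) - linearInterpolation V ((⌊s⌋₊ : ℝ) + 1)| ≤
        C * ((⌊t⌋₊ : ℝ) - (⌊s⌋₊ + 1)) := by
      rcases hle.eq_or_lt with h1 | h1
      · rw [h1]; simp
      · have h2 : ((⌊s⌋₊ + 1 : ℕ) : ℝ) < ⌊t⌋₊ := by push_cast; exact h1
        have h3 : ((⌊s⌋₊ : ℝ) + 1) + 1 ≤ ⌊t⌋₊ := by exact_mod_cast h2
        have h4 := hC ⌊t⌋₊ (⌊s⌋₊ + 1)
        rw [← linearInterpolation_natCast (V := V), ← linearInterpolation_natCast (V := V)] at h4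
        push_cast at h4
        exact h4.trans (le_mul_of_one_le_right hC0 (by linarith))
    have h5 := abs_sub_le (linearInterpolation V t) (linearInterpolation V (⌊t⌋₊ : ℝ))
      (linearInterpolation V s)
    have h6 := abs_sub_le (linearInterpolation V (⌊t⌋₊ : ℝ))
      (linearInterpolation V ((⌊s⌋₊ : ℝ) + 1)) (linearInterpolation V s)
    linarith

lemma continuousOn_linearInterpolation {C : ℝ} (hV : ∀ n, V n ∈ Icc 0 C) :
    ContinuousOn (linearInterpolation V) (Ici 0) := by
  have : LipschitzOnWith C.toNNReal (linearInterpolation V) (Ici 0) := by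
    refine LipschitzOnWith.of_dist_le_mul fun x hx y hy => ?_
    have hx : 0 ≤ x := hx
    have hy : 0 ≤ y := hy
    rw [Real.coe_toNNReal C ((hV 0).1.trans (hV 0).2)]
    rcases le_total y x with h | h
    · have := abs_linearInterpolation_sub_le hV hy h
      rwa [Real.dist_eq, Real.dist_eq, abs_of_nonneg (sub_nonneg.2 h)]
    · have := abs_linearInterpolation_sub_le hV hx h
      rwa [dist_comm, dist_comm x, Real.dist_eq, Real.dist_eq, abs_of_nonneg (sub_nonneg.2 h)]
  exact this.continuousOn

end Interpolation

/-! ### Zigzags along a walk -/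

section Zigzag

/-- The vertices of the zigzag along `w`. The times `n` with `Nat.sqrt n = i`, that is
`i ^ 2 ≤ n ≤ i ^ 2 + 2 * i`, form the `i`-th block, during which the zigzag oscillates over the
edge `[2 * w i, 2 * w i + 1]`. -/
noncomputable def zigzagVertex (w : ℕ → Fin 4) (n : ℕ) : ℝ :=
  2 * ((w n.sqrt : ℕ) : ℝ) + ((n % 2 : ℕ) : ℝ)

/-- The zigzag along a walk `w` on four positions: a piecewise linear function which oscillates
more and more often over each of the disjoint edges `[2 * w i, 2 * w i + 1]` in turn. -/
noncomputable def zigzag (w : ℕ → Fin 4) : ℝ → ℝ := linearInterpolation (zigzagVertex w)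

variable {w v : ℕ → Fin 4}

lemma zigzagVertex_mem_edge (n : ℕ) :
    zigzagVertex w n ∈ Icc (2 * ((w n.sqrt : ℕ) : ℝ)) (2 * ((w n.sqrt : ℕ) : ℝ) + 1) := by
  have h1 : ((n % 2 : ℕ) : ℝ) ≤ 1 := by exact_mod_cast (by omega : n % 2 ≤ 1)
  have h2 : (0 : ℝ) ≤ ((n % 2 : ℕ) : ℝ) := Nat.cast_nonneg _
  constructor <;> simp only [zigzagVertex] <;> linarith

lemma zigzagVertex_mem_Icc (n : ℕ) : zigzagVertex w n ∈ Icc (0 : ℝ) 7 := by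
  obtain ⟨h1, h2⟩ := zigzagVertex_mem_edge (w := w) n
  have h3 : ((w n.sqrt : ℕ) : ℝ) ≤ 3 := by exact_mod_cast (by omega : (w n.sqrt : ℕ) ≤ 3)
  have h4 : (0 : ℝ) ≤ ((w n.sqrt : ℕ) : ℝ) := Nat.cast_nonneg _
  constructor <;> linarith

lemma continuousOn_zigzag : ContinuousOn (zigzag w) (Ici 0) :=
  continuousOn_linearInterpolation zigzagVertex_mem_Icc

lemma zigzag_mem_Icc {t : ℝ} (ht : 0 ≤ t) : zigzag w t ∈ Icc (0 : ℝ) 7 :=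
  linearInterpolation_mem_Icc (a := 0) (b := ⌈t⌉₊) (fun n _ _ => zigzagVertex_mem_Icc n)
    ⟨by simpa using ht, Nat.le_ceil t⟩

/-- Consecutive vertices differ by an odd integer. -/
lemma one_le_abs_zigzagVertex_sub (n : ℕ) :
    1 ≤ |zigzagVertex w (n + 1) - zigzagVertex w n| := by
  set k : ℤ := 2 * (w (n + 1).sqrt : ℕ) + ((n + 1) % 2 : ℕ) -
    (2 * (w n.sqrt : ℕ) + (n % 2 : ℕ)) with hk
  have h1 : zigzagVertex w (n + 1) - zigzagVertex w n = (k : ℝ) := by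
    simp only [zigzagVertex, hk, Int.cast_sub, Int.cast_add, Int.cast_mul, Int.cast_ofNat,
      Int.cast_natCast]
  have h2 : k ≠ 0 := by omega
  rw [h1]
  exact_mod_cast Int.one_le_abs h2

lemma exists_zigzag_eq {n : ℕ} (hn : (n + 1).sqrt = n.sqrt) {y : ℝ}
    (hy : y ∈ Icc (2 * ((w n.sqrt : ℕ) : ℝ)) (2 * ((w n.sqrt : ℕ) : ℝ) + 1)) :
    ∃ t ∈ Icc (n : ℝ) (n + 1), zigzag w t = y := by
  have hcont : ContinuousOn (zigzag w) (Icc (n : ℝ) (n + 1)) :=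
    continuousOn_zigzag.mono fun t ht => n.cast_nonneg.trans ht.1
  have h1 : zigzag w n = zigzagVertex w n := linearInterpolation_natCast n
  have h2 : zigzag w (n + 1) = zigzagVertex w (n + 1) := by
    exact_mod_cast linearInterpolation_natCast (V := zigzagVertex w) (n + 1)
  rcases Nat.mod_two_eq_zero_or_one n with h | h
  · have h' : (n + 1) % 2 = 1 := by omega
    have := intermediate_value_Icc (by linarith) hcont
    rw [h1, h2, zigzagVertex, zigzagVertex, hn, h, h'] at this
    exact this (by simpa using hy)
  · have h' : (n + 1) % 2 = 0 := by omega
    have := intermediate_value_Icc' (by linarith) hcont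
    rw [h1, h2, zigzagVertex, zigzagVertex, hn, h, h'] at this
    exact this (by simpa using hy)

/-- Every long time interval contains a unit step inside a single block. -/
lemma exists_step {a b : ℝ} (ha : 0 ≤ a) (hab : a + 4 ≤ b) :
    ∃ n : ℕ, a ≤ n ∧ n + 1 ≤ b ∧ (n + 1).sqrt = n.sqrt := by
  have h1 := Nat.le_ceil a
  have h2 := Nat.ceil_lt_add_one ha
  by_cases h : (⌈a⌉₊ + 1).sqrt = ⌈a⌉₊.sqrt
  · exact ⟨⌈a⌉₊, h1, by linarith, h⟩
  · refine ⟨⌈a⌉₊ + 1, by push_cast; linarith, by push_cast; linarith, ?_⟩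
    -- the first time of a block is followed by another one of the same block
    set n := ⌈a⌉₊
    set i := n.sqrt with hi
    have h3 : i < (n + 1).sqrt := (Nat.sqrt_le_sqrt n.le_succ).lt_of_ne' h
    have h4 : n < (i + 1) ^ 2 := Nat.sqrt_lt'.1 (Nat.lt_succ_self i)
    have h5 : (i + 1) ^ 2 ≤ n + 1 := Nat.le_sqrt'.1 h3
    have h6 : (n + 1).sqrt = i + 1 :=
      Nat.eq_sqrt'.2 ⟨h5, by nlinarith⟩ |>.symm
    rw [h6]
    exact (Nat.eq_sqrt'.2 ⟨by omega, by nlinarith⟩).symm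

end Zigzag

/-! ### Maps between zigzag compactifications -/

section Factor

/-- Between a time when `τ ≤ a` and a later time when `b ≤ τ`, there is an interval on which `τ`
crosses from `a` to `b` within `[a, b]`. -/
lemma exists_crossing {τ : ℝ → ℝ} {s t a b : ℝ} (hst : s ≤ t) (hτ : ContinuousOn τ (Icc s t))
    (ha : τ s ≤ a) (hab : a ≤ b) (hb : b ≤ τ t) :
    ∃ s' t', s ≤ s' ∧ s' ≤ t' ∧ t' ≤ t ∧ τ s' = a ∧ τ t' = b ∧ MapsTo τ (Icc s' t') (Icc a b) := by
  -- `t'` is the first time when `τ = b`, and `s'` the last time before `t'` when `τ = a`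
  have hfib : ∀ {x y c}, s ≤ x → y ≤ t → IsCompact (Icc x y ∩ τ ⁻¹' {c}) := fun hx hy =>
    isCompact_Icc.of_isClosed_subset
      ((hτ.mono (Icc_subset_Icc hx hy)).preimage_isClosed_of_isClosed isClosed_Icc
        isClosed_singleton) inter_subset_left
  obtain ⟨x, hx, hxb⟩ := intermediate_value_Icc hst hτ ⟨ha.trans hab, hb⟩
  obtain ⟨t', ⟨ht', htb⟩, hmin⟩ := (hfib (c := b) le_rfl le_rfl).exists_isLeast ⟨x, hx, hxb⟩
  have htb : τ t' = b := htb
  obtain ⟨z, hz, hza⟩ := intermediate_value_Icc ht'.1 (hτ.mono (Icc_subset_Icc_right ht'.2))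
    ⟨ha, hab.trans htb.ge⟩
  obtain ⟨s', ⟨hs', hsa⟩, hmax⟩ := (hfib (c := a) le_rfl ht'.2).exists_isGreatest ⟨z, hz, hza⟩
  refine ⟨s', t', hs'.1, hs'.2, ht'.2, hsa, htb, fun u hu => ⟨?_, ?_⟩⟩
  · by_contra! hlt
    obtain ⟨y, hy, hya⟩ := intermediate_value_Icc hu.2
      (hτ.mono (Icc_subset_Icc (hs'.1.trans hu.1) ht'.2)) ⟨hlt.le, hab.trans htb.ge⟩
    have h1 : y ≤ s' := hmax ⟨⟨(hs'.1.trans hu.1).trans hy.1, hy.2⟩, hya⟩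
    have h2 : u = s' := le_antisymm (hy.1.trans h1) hu.1
    rw [h2] at hlt
    exact hlt.ne hsa
  · by_contra! hlt
    obtain ⟨y, hy, hyb⟩ := intermediate_value_Icc (hs'.1.trans hu.1)
      (hτ.mono (Icc_subset_Icc_right (hu.2.trans ht'.2))) ⟨ha.trans hab, hlt.le⟩
    have h1 : t' ≤ y := hmin ⟨⟨hy.1, hy.2.trans (hu.2.trans ht'.2)⟩, hyb⟩
    have h2 : u = t' := le_antisymm hu.2 (h1.trans hy.2)
    rw [h2] at hlt
    exact hlt.ne' htb

/-- What a map between two zigzag compactifications that sends ray to ray and remainder to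
remainder amounts to: `α` is the map of the remainders, `τ` the map of the rays, and the two fit
together approximately from time `T` on. -/
structure IsAsymptoticFactor (w v : ℕ → Fin 4) (α τ : ℝ → ℝ) (T : ℝ) : Prop where
  nonneg : 0 ≤ T
  continuousOn_remainder : ContinuousOn α (Icc 0 7)
  continuousOn_ray : ContinuousOn τ (Ici 0)
  ray_nonneg : ∀ t, 0 ≤ t → 0 ≤ τ t
  tendsto : Filter.Tendsto τ Filter.atTop Filter.atTop
  close : ∀ t, T ≤ t → |α (zigzag w t) - zigzag v (τ t)| ≤ 1 / 8

/-- The map `α` sends the edge at position `q` into a neighborhood of the edge at `p`. -/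
def MapsEdge (α : ℝ → ℝ) (q p : Fin 4) : Prop :=
  ∀ y ∈ Icc (2 * ((q : ℕ) : ℝ)) (2 * ((q : ℕ) : ℝ) + 1),
    α y ∈ Icc (2 * ((p : ℕ) : ℝ) - 1 / 8) (2 * ((p : ℕ) : ℝ) + 1 + 1 / 8)

lemma MapsEdge.unique {α : ℝ → ℝ} {q p p' : Fin 4} (h : MapsEdge α q p) (h' : MapsEdge α q p') :
    p = p' := by
  have h1 := h _ (left_mem_Icc.2 (by linarith))
  have h2 := h' _ (left_mem_Icc.2 (by linarith))
  have key : ∀ {a b : ℕ}, 2 * (a : ℝ) - 1 / 8 ≤ 2 * (b : ℝ) + 1 + 1 / 8 → a ≤ b := by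
    intro a b hab
    by_contra! hlt
    have : (b : ℝ) + 1 ≤ a := by exact_mod_cast hlt
    linarith
  exact Fin.ext (le_antisymm (key (h1.1.trans h2.2)) (key (h2.1.trans h1.2)))

namespace IsAsymptoticFactor

variable {w v : ℕ → Fin 4} {α τ : ℝ → ℝ} {T : ℝ}

/-- By uniform continuity of `α`, going through `k` unit steps of the target ray takes a time
proportional to `k`. -/
lemma exists_duration (H : IsAsymptoticFactor w v α τ T) :
    ∃ δ : ℝ, 0 < δ ∧ ∀ (k n : ℕ) (s t : ℝ), T ≤ s → s ≤ t → τ s = n → τ t = n + k →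
      k * δ ≤ t - s := by
  obtain ⟨η, hη, hα⟩ := Metric.uniformContinuousOn_iff.1
    (isCompact_Icc.uniformContinuousOn_of_continuous H.continuousOn_remainder) (1 / 2) (by norm_num)
  refine ⟨η / 8, by positivity, fun k => ?_⟩
  induction k with
  | zero => intro n s t _ hst _ _; simpa using hst
  | succ k ih =>
    intro n s t hTs hst hs ht
    have hs0 : 0 ≤ s := H.nonneg.trans hTs
    push_cast at ht
    obtain ⟨u, hu, hτu⟩ := intermediate_value_Icc hst
      (H.continuousOn_ray.mono fun x hx => hs0.trans hx.1)
      (show (n : ℝ) + k ∈ Icc (τ s) (τ t) by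
        rw [hs, ht]; constructor <;> linarith [(Nat.cast_nonneg k : (0 : ℝ) ≤ k)])
    have h1 := ih n s u hTs hu.1 hs hτu
    suffices h2 : η / 8 ≤ t - u by push_cast; linarith
    by_contra! hlt
    have hu0 : 0 ≤ u := hs0.trans hu.1
    have h3 : |zigzag w t - zigzag w u| ≤ 7 * (t - u) :=
      abs_linearInterpolation_sub_le zigzagVertex_mem_Icc hu0 hu.2
    have h4 := hα _ (zigzag_mem_Icc (w := w) (hu0.trans hu.2)) _ (zigzag_mem_Icc (w := w) hu0)
      (by rw [Real.dist_eq]; linarith)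
    rw [Real.dist_eq] at h4
    have h5 := H.close u (hTs.trans hu.1)
    have h6 := H.close t (hTs.trans hst)
    have h7 := one_le_abs_zigzagVertex_sub (w := v) (n + k)
    have h8 : zigzag v (τ u) = zigzagVertex v (n + k) := by
      rw [hτu]; exact_mod_cast linearInterpolation_natCast (V := zigzagVertex v) (n + k)
    have h9 : zigzag v (τ t) = zigzagVertex v (n + k + 1) := by
      rw [ht]; exact_mod_cast linearInterpolation_natCast (V := zigzagVertex v) (n + k + 1)
    rw [h8] at h5
    rw [h9] at h6
    rw [abs_le] at h5 h6
    rw [abs_lt] at h4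
    rw [le_abs] at h7
    rcases h7 with h7 | h7 <;> linarith [h4.1, h4.2, h5.1, h5.2, h6.1, h6.2]

/-- During a unit step inside a block the zigzag runs through its whole edge, so bounds on the
target ray during this step bound the image of the edge. -/
lemma apply_mem_of_step (H : IsAsymptoticFactor w v α τ T) {n : ℕ} (hT : T ≤ n)
    (hn : (n + 1).sqrt = n.sqrt) {lo hi : ℝ}
    (hτ : ∀ t ∈ Icc (n : ℝ) (n + 1), zigzag v (τ t) ∈ Icc lo hi) {y : ℝ}
    (hy : y ∈ Icc (2 * ((w n.sqrt : ℕ) : ℝ)) (2 * ((w n.sqrt : ℕ) : ℝ) + 1)) :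
    α y ∈ Icc (lo - 1 / 8) (hi + 1 / 8) := by
  obtain ⟨t, ht, rfl⟩ := exists_zigzag_eq hn hy
  have h1 := H.close t (hT.trans ht.1)
  have h2 := hτ t ht
  rw [abs_le] at h1
  constructor <;> linarith [h1.1, h1.2, h2.1, h2.2]

/-- While `τ` crosses a late block of `v`, there is a step inside a block of `w` whose edge is mapped
to the edge of the crossed block. -/
lemma exists_mapsEdge_of_crossing (H : IsAsymptoticFactor w v α τ T) :
    ∃ j₀ : ℕ, ∀ j ≥ j₀, ∀ s t : ℝ, T ≤ s → s ≤ t → τ s ≤ (j : ℝ) ^ 2 →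
      (j : ℝ) ^ 2 + 2 * j ≤ τ t →
      ∃ n : ℕ, s ≤ n ∧ n + 1 ≤ t ∧ (n + 1).sqrt = n.sqrt ∧ MapsEdge α (w n.sqrt) (v j) := by
  obtain ⟨δ, hδ, hdur⟩ := H.exists_duration
  refine ⟨⌈2 / δ⌉₊, fun j hj s t hTs hst hs ht => ?_⟩
  have hs0 : 0 ≤ s := H.nonneg.trans hTs
  have hj0 : (0 : ℝ) ≤ j := Nat.cast_nonneg j
  obtain ⟨s', t', h1, h2, h3, hs', ht', hmaps⟩ := exists_crossing hst
    (H.continuousOn_ray.mono fun x hx => hs0.trans hx.1) hs (by linarith) ht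
  have h4 := hdur (2 * j) (j ^ 2) s' t' (hTs.trans h1) h2 (by push_cast; exact hs')
    (by push_cast; exact ht')
  have h5 : 2 ≤ j * δ := (div_le_iff₀ hδ).1 (Nat.ceil_le.1 hj)
  push_cast at h4
  obtain ⟨n, hn1, hn2, hn⟩ := exists_step (hs0.trans h1) (by linarith : s' + 4 ≤ t')
  refine ⟨n, h1.trans hn1, hn2.trans h3, hn, fun y hy => ?_⟩
  refine H.apply_mem_of_step ((hTs.trans h1).trans hn1) hn (fun u hu => ?_) hy
  have h6 := hmaps ⟨hn1.trans hu.1, hu.2.trans hn2⟩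
  refine linearInterpolation_mem_Icc (a := j ^ 2) (b := j ^ 2 + 2 * j) (fun m hm1 hm2 => ?_)
    (by push_cast; exact h6)
  have h7 : m.sqrt = j := (Nat.eq_sqrt'.2 ⟨hm1, by nlinarith⟩).symm
  have := zigzagVertex_mem_edge (w := v) m
  rwa [h7] at this

/-- The map `α` permutes the edges, and turns of the walk `v` that occur infinitely often lift to
turns of the walk `w`: while `τ` crosses three late blocks of `v` at the positions `p', p, p'`, the
zigzag along `w` can only be in blocks at the positions `ρ p'` and `ρ p`, and it visits them in this
order. -/
theorem exists_injective_turns (H : IsAsymptoticFactor w v α τ T) (hw : ∀ i, w i ≠ w (i + 1))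
    (hv : ∀ p, ∃ᶠ j in Filter.atTop, v j = p) :
    ∃ ρ : Fin 4 → Fin 4, Function.Injective ρ ∧ ∀ p p' : Fin 4,
      ((p : ℕ) = p' + 1 ∨ (p' : ℕ) = p + 1) →
      (∃ᶠ j in Filter.atTop, v j = p' ∧ v (j + 1) = p ∧ v (j + 2) = p') →
      ∃ i, w i = ρ p' ∧ w (i + 1) = ρ p ∧ w (i + 2) = ρ p' := by
  obtain ⟨j₀, hj₀⟩ := H.exists_mapsEdge_of_crossing
  have hlate : ∀ᶠ j : ℕ in Filter.atTop, j₀ ≤ j ∧ τ T ≤ (j : ℝ) ^ 2 := by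
    refine (Filter.eventually_ge_atTop j₀).and ?_
    exact ((Filter.tendsto_pow_atTop two_ne_zero).comp tendsto_natCast_atTop_atTop).eventually
      (Filter.eventually_ge_atTop (τ T))
  have hfar : ∀ b : ℝ, ∃ t, T ≤ t ∧ b ≤ τ t := fun b =>
    ((Filter.eventually_ge_atTop T).and (H.tendsto.eventually (Filter.eventually_ge_atTop b))).exists
  have hex : ∀ p, ∃ q, MapsEdge α q p := by
    intro p
    obtain ⟨j, rfl, hj1, hj2⟩ := ((hv p).and_eventually hlate).exists
    obtain ⟨t, htT, ht⟩ := hfar ((j : ℝ) ^ 2 + 2 * j)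
    obtain ⟨n, -, -, -, hn⟩ := hj₀ j hj1 T t le_rfl htT hj2 ht
    exact ⟨_, hn⟩
  choose ρ hρ using hex
  have hinj : Function.Injective ρ := fun p p' h => (hρ p).unique (h ▸ hρ p')
  have hsurj : Function.Surjective ρ := Finite.surjective_of_injective hinj
  have huniq : ∀ {q p}, MapsEdge α q p → q = ρ p := by
    intro q p h
    obtain ⟨p', rfl⟩ := hsurj q
    rw [(hρ p').unique h]
  refine ⟨ρ, hinj, fun p p' hpp hturn => ?_⟩
  have hne : p ≠ p' := by rintro rfl; omega
  obtain ⟨j, ⟨hv0, hv1, hv2⟩, hj1, hj2⟩ := (hturn.and_eventually hlate).exists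
  have hj0 : (0 : ℝ) ≤ j := Nat.cast_nonneg j
  obtain ⟨t, htT, ht⟩ := hfar (((j : ℝ) + 2) ^ 2 + 2 * ((j : ℝ) + 2))
  obtain ⟨a, b, hTa, hab, -, hτa, hτb, hmaps⟩ := exists_crossing htT
    (H.continuousOn_ray.mono fun x hx => H.nonneg.trans hx.1) hj2 (by nlinarith) ht
  have ha0 : 0 ≤ a := H.nonneg.trans hTa
  have hcont : ∀ {x y}, a ≤ x → ContinuousOn τ (Icc x y) := fun hx =>
    H.continuousOn_ray.mono fun z hz => ha0.trans (hx.trans hz.1)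
  obtain ⟨u, hu, hτu⟩ := intermediate_value_Icc hab (hcont le_rfl)
    (show ((j : ℝ) + 1) ^ 2 ∈ Icc (τ a) (τ b) by
      rw [hτa, hτb]; constructor <;> nlinarith)
  obtain ⟨u', hu', hτu'⟩ := intermediate_value_Icc hu.2 (hcont hu.1)
    (show ((j : ℝ) + 2) ^ 2 ∈ Icc (τ u) (τ b) by
      rw [hτu, hτb]; constructor <;> nlinarith)
  obtain ⟨n₁, hn1a, hn1u, hn1, hm1⟩ := hj₀ j hj1 a u hTa hu.1 hτa.le (by rw [hτu]; nlinarith)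
  obtain ⟨n₂, hn2u, hn2u', hn2, hm2⟩ := hj₀ (j + 1) (by omega) u u' (hTa.trans hu.1) hu'.1
    (by push_cast; exact hτu.le) (by push_cast; rw [hτu']; nlinarith)
  obtain ⟨n₃, hn3u', hn3b, hn3, hm3⟩ := hj₀ (j + 2) (by omega) u' b
    (hTa.trans (hu.1.trans hu'.1)) hu'.2 (by push_cast; exact hτu'.le) (by push_cast; exact hτb.ge)
  rw [hv0] at hm1
  rw [hv1] at hm2
  rw [hv2] at hm3
  -- in the time interval `[a, b]` only two positions of `w` are visited
  have hvis : ∀ n : ℕ, a ≤ n → n + 1 ≤ b → (n + 1).sqrt = n.sqrt →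
      w n.sqrt = ρ p ∨ w n.sqrt = ρ p' := by
    intro n hna hnb hn
    obtain ⟨r, hr⟩ := hsurj (w n.sqrt)
    have h1 := hρ r _ (left_mem_Icc.2 (by linarith))
    have h2 := H.apply_mem_of_step (lo := 2 * ((min p p' : ℕ) : ℝ))
      (hi := 2 * ((max p p' : ℕ) : ℝ) + 1) (hTa.trans hna) hn (fun x hx => ?_)
      (left_mem_Icc.2 (by linarith))
    · rw [← hr] at h2
      have key : ∀ {k l : ℕ}, 2 * (k : ℝ) - 1 / 8 ≤ 2 * (l : ℝ) + 1 + 1 / 8 → k ≤ l := by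
        intro k l hkl
        by_contra! hlt
        have : (l : ℝ) + 1 ≤ k := by exact_mod_cast hlt
        linarith
      have h3 := key (h1.1.trans h2.2)
      have h4 := key (h2.1.trans h1.2)
      have h5 : r = p ∨ r = p' := by
        rcases hpp with h | h <;> simp only [Fin.ext_iff] <;> omega
      rw [← hr]
      exact h5.imp (congrArg ρ) (congrArg ρ)
    · have h3 := hmaps ⟨hna.trans hx.1, hx.2.trans hnb⟩
      refine linearInterpolation_mem_Icc (a := j ^ 2) (b := (j + 2) ^ 2 + 2 * (j + 2))
        (fun m hm1 hm2 => ?_) (by push_cast; exact h3)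
      have h4 : j ≤ m.sqrt := Nat.le_sqrt'.2 hm1
      have h5 : m.sqrt < j + 3 := Nat.sqrt_lt'.2 (by nlinarith)
      have h6 : v m.sqrt = p ∨ v m.sqrt = p' := by
        obtain h | h | h : m.sqrt = j ∨ m.sqrt = j + 1 ∨ m.sqrt = j + 2 := by omega
        · exact .inr (h ▸ hv0)
        · exact .inl (h ▸ hv1)
        · exact .inr (h ▸ hv2)
      have h7 : (min p p' : ℕ) ≤ (v m.sqrt : ℕ) ∧ (v m.sqrt : ℕ) ≤ (max p p' : ℕ) := by
        rcases h6 with h | h <;> rw [h] <;> omega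
      have h8 : ((min p p' : ℕ) : ℝ) ≤ ((v m.sqrt : ℕ) : ℝ) := by exact_mod_cast h7.1
      have h9 : ((v m.sqrt : ℕ) : ℝ) ≤ ((max p p' : ℕ) : ℝ) := by exact_mod_cast h7.2
      obtain ⟨h10, h11⟩ := zigzagVertex_mem_edge (w := v) m
      constructor <;> linarith
  have h12 : n₁ + 1 ≤ n₂ := by exact_mod_cast hn1u.trans hn2u
  have h23 : n₂ + 1 ≤ n₃ := by exact_mod_cast hn2u'.trans hn3u'
  have hmid : ∀ i, n₁.sqrt < i → i < n₃.sqrt → w i = ρ p ∨ w i = ρ p' := by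
    intro i hi1 hi3
    have h1 : n₁ < i ^ 2 := Nat.sqrt_lt'.1 hi1
    have h3 : (i + 1) ^ 2 ≤ n₃ := Nat.le_sqrt'.1 hi3
    have h4 : i ^ 2 + 1 ≤ n₃ := by nlinarith
    have hi0 : 0 < i := by omega
    have s1 : (i ^ 2).sqrt = i := Nat.sqrt_eq' i
    have s2 : (i ^ 2 + 1).sqrt = i := (Nat.eq_sqrt'.2 ⟨by omega, by nlinarith⟩).symm
    have h5 : ((n₁ : ℝ)) ≤ ((i ^ 2 : ℕ) : ℝ) := by exact_mod_cast h1.le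
    have h6 : ((i ^ 2 : ℕ) : ℝ) + 1 ≤ (n₃ : ℝ) := by exact_mod_cast h4
    have := hvis (i ^ 2) (hn1a.trans h5) (by linarith) (by rw [s1, s2])
    rwa [s1] at this
  have e1 := huniq hm1
  have e2 := huniq hm2
  have e3 := huniq hm3
  have hne' : ρ p ≠ ρ p' := fun h => hne (hinj h)
  have l12 : n₁.sqrt < n₂.sqrt := (Nat.sqrt_le_sqrt (by omega)).lt_of_ne fun h =>
    hne' (by rw [← e2, ← h, e1])
  have l23 : n₂.sqrt < n₃.sqrt := (Nat.sqrt_le_sqrt (by omega)).lt_of_ne fun h =>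
    hne' (by rw [← e2, h, e3])
  obtain ⟨i, hi⟩ : ∃ i, n₂.sqrt = i + 1 := ⟨n₂.sqrt - 1, by omega⟩
  rw [hi] at e2 l12 l23
  refine ⟨i, ?_, e2, ?_⟩
  · rcases (Nat.lt_succ_iff.1 l12).eq_or_lt with h | h
    · rw [← h, e1]
    · exact (hmid i h (by omega)).resolve_left fun h' => hw i (by rw [h', e2])
  · rcases (Nat.succ_le_of_lt l23).eq_or_lt with h | h
    · rw [show i + 2 = n₃.sqrt from h, e3]
    · exact (hmid (i + 2) (by omega) h).resolve_left fun h' => hw (i + 1) (by rw [h', e2])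

end IsAsymptoticFactor

end Factor

/-! ### Zigzag compactifications of a ray -/

section Compactum

variable {w v : ℕ → Fin 4}

/-- The ray in the plane that follows the zigzag along `w` while approaching the line `x = 1`. -/
noncomputable def zigzagCurve (w : ℕ → Fin 4) (t : ℝ) : ℝ × ℝ := (t / (1 + t), zigzag w t)

/-- The compactification of `zigzagCurve w` in the plane, with the arc `{1} × [0, 7]` as
remainder. -/
def zigzagCompactum (w : ℕ → Fin 4) : Set (ℝ × ℝ) :=
  {p | p.1 = 1 ∧ p.2 ∈ Icc 0 7} ∪ zigzagCurve w '' Ici 0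

lemma zigzagCurve_mem {t : ℝ} (ht : 0 ≤ t) : zigzagCurve w t ∈ zigzagCompactum w :=
  .inr ⟨t, ht, rfl⟩

lemma zigzagCurve_fst_mem {t : ℝ} (ht : 0 ≤ t) : (zigzagCurve w t).1 ∈ Ico (0 : ℝ) 1 := by
  simp only [zigzagCurve]
  exact ⟨by positivity, by rw [div_lt_one (by positivity)]; linarith⟩

lemma zigzagCurve_param {t : ℝ} (ht : 0 ≤ t) :
    (zigzagCurve w t).1 / (1 - (zigzagCurve w t).1) = t := by
  simp only [zigzagCurve]
  have : 1 - t / (1 + t) = 1 / (1 + t) := by field_simp; ring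
  rw [this]
  field_simp

lemma continuousOn_zigzagCurve : ContinuousOn (zigzagCurve w) (Ici 0) := by
  refine ContinuousOn.prodMk (continuousOn_id.div (by fun_prop) fun t ht => ?_) continuousOn_zigzag
  have : (0 : ℝ) ≤ t := ht
  positivity

lemma mem_zigzagCompactum_of_fst_lt {p : ℝ × ℝ} (hp : p ∈ zigzagCompactum w) (h : p.1 < 1) :
    0 ≤ p.1 / (1 - p.1) ∧ zigzagCurve w (p.1 / (1 - p.1)) = p := by
  rcases hp with hp | ⟨t, ht, rfl⟩
  · exact absurd hp.1 h.ne
  · rw [zigzagCurve_param ht]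
    exact ⟨ht, rfl⟩

lemma zigzagCompactum_subset : zigzagCompactum w ⊆ Icc 0 1 ×ˢ Icc 0 7 := by
  rintro p (⟨hp, hp2⟩ | ⟨t, ht, rfl⟩)
  · exact ⟨by rw [hp]; norm_num, hp2⟩
  · exact ⟨Ico_subset_Icc_self (zigzagCurve_fst_mem ht), zigzag_mem_Icc ht⟩

lemma isCompact_zigzagCompactum : IsCompact (zigzagCompactum w) := by
  refine (isCompact_Icc.prod isCompact_Icc).of_isClosed_subset ?_ zigzagCompactum_subset
  refine isClosed_of_closure_subset fun p hp => ?_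
  have hbox := closure_minimal zigzagCompactum_subset (isClosed_Icc.prod isClosed_Icc) hp
  rcases hbox.1.2.eq_or_lt with h1 | h1
  · exact .inl ⟨h1, hbox.2⟩
  -- to the left of a vertical line `x = b` with `b < 1`, the set is a compact part of the curve
  obtain ⟨b, hpb, hb1⟩ := exists_between h1
  have hC : IsCompact (zigzagCurve w '' Icc 0 (b / (1 - b))) :=
    isCompact_Icc.image_of_continuousOn (continuousOn_zigzagCurve.mono Icc_subset_Ici_self)
  have hopen : IsOpen {p : ℝ × ℝ | p.1 < b} := isOpen_lt continuous_fst continuous_const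
  have hsub : {p : ℝ × ℝ | p.1 < b} ∩ zigzagCompactum w ⊆ zigzagCurve w '' Icc 0 (b / (1 - b)) := by
    rintro q ⟨hq, hqK⟩
    have hq : q.1 < b := hq
    obtain ⟨h2, h3⟩ := mem_zigzagCompactum_of_fst_lt hqK (hq.trans hb1)
    refine ⟨_, ⟨h2, ?_⟩, h3⟩
    rw [div_le_div_iff₀ (by linarith) (by linarith)]
    nlinarith
  obtain ⟨t, ht, rfl⟩ := closure_minimal hsub hC.isClosed (hopen.inter_closure ⟨hpb, hp⟩)
  exact zigzagCurve_mem ht.1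

lemma exists_ge_zigzag_eq (hw : ∀ p, ∃ᶠ i in Filter.atTop, w i = p) (N : ℝ) {y : ℝ}
    (hy : y ∈ Icc (0 : ℝ) 7) : ∃ t, N ≤ t ∧ 0 ≤ t ∧ zigzag w t = y := by
  have key : ∀ p : Fin 4, ∀ z ∈ Icc (2 * ((p : ℕ) : ℝ)) (2 * ((p : ℕ) : ℝ) + 1),
      ∃ t, N ≤ t ∧ 0 ≤ t ∧ zigzag w t = z := by
    intro p z hz
    obtain ⟨i, hi, hpi⟩ := Filter.frequently_atTop.1 (hw p) (⌈N⌉₊ + 1)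
    have s1 : (i ^ 2).sqrt = i := Nat.sqrt_eq' i
    have s2 : (i ^ 2 + 1).sqrt = i := (Nat.eq_sqrt'.2 ⟨by omega, by nlinarith⟩).symm
    obtain ⟨t, ht, hzt⟩ := exists_zigzag_eq (w := w) (n := i ^ 2) (by rw [s1, s2])
      (by rw [s1, hpi]; exact hz)
    have h1 : N ≤ ⌈N⌉₊ := Nat.le_ceil N
    have h2 : ((⌈N⌉₊ : ℕ) : ℝ) ≤ ((i ^ 2 : ℕ) : ℝ) := by exact_mod_cast (by nlinarith)
    exact ⟨t, h1.trans (h2.trans ht.1), (Nat.cast_nonneg _).trans ht.1, hzt⟩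
  obtain ⟨a, hNa, ha0, ha⟩ := key 0 0 (by norm_num)
  obtain ⟨b, hNb, hb0, hb⟩ := key 3 7 (by norm_num)
  have hab : ∀ t ∈ uIcc a b, N ≤ t ∧ 0 ≤ t := fun t ht =>
    ⟨(le_min hNa hNb).trans ht.1, (le_min ha0 hb0).trans ht.1⟩
  obtain ⟨t, ht, hty⟩ := intermediate_value_uIcc
    (continuousOn_zigzag (w := w).mono fun t ht => (hab t ht).2)
    (show y ∈ uIcc (zigzag w a) (zigzag w b) by rw [ha, hb, uIcc_of_le (by norm_num)]; exact hy)
  exact ⟨t, (hab t ht).1, (hab t ht).2, hty⟩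

lemma dist_zigzagCurve {t : ℝ} (ht : 0 ≤ t) :
    dist (zigzagCurve w t) (1, zigzag w t) = 1 / (1 + t) := by
  have h1 : t / (1 + t) - 1 = -(1 / (1 + t)) := by field_simp; ring
  simp only [zigzagCurve, Prod.dist_eq, dist_self, Real.dist_eq]
  rw [h1, abs_neg, abs_of_nonneg (by positivity), max_eq_left (by positivity)]

lemma zigzagCompactum_subset_closure (hw : ∀ p, ∃ᶠ i in Filter.atTop, w i = p) :
    zigzagCompactum w ⊆ closure (zigzagCurve w '' Ici 0) := by
  rintro p (⟨hp1, hp2⟩ | hp)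
  · rw [Metric.mem_closure_iff]
    intro ε hε
    obtain ⟨t, ht, ht0, hty⟩ := exists_ge_zigzag_eq hw (1 / ε) hp2
    refine ⟨_, ⟨t, ht0, rfl⟩, ?_⟩
    have : p = (1, zigzag w t) := Prod.ext hp1 hty.symm
    rw [this, dist_comm, dist_zigzagCurve ht0, div_lt_iff₀ (by positivity)]
    rw [div_le_iff₀ hε] at ht
    linarith
  · exact subset_closure hp

/-- If the right half plane meets an embedded copy of `X` in a zigzag compactum, then the
corresponding part of `X` is a compactification of a ray with arc remainder. -/
lemma isRayCompactification_of_isEmbedding {X : Type*} [TopologicalSpace X] {ι : X → ℝ × ℝ}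
    (hι : IsEmbedding ι) (hw : ∀ p, ∃ᶠ i in Filter.atTop, w i = p)
    (hK : range ι ∩ {p | 0 ≤ p.1} = zigzagCompactum w) {x₀ : X} (hx₀ : (ι x₀).1 = 0) :
    IsRayCompactificationWithArcRemainder (ι ⁻¹' {p | p.1 = 1}) (ι ⁻¹' {p | p.1 ∈ Ico 0 1}) x₀ := by
  have : Nonempty X := ⟨x₀⟩
  set s : ℝ × ℝ → X := Function.invFun ι
  have hsι : ∀ x, s (ι x) = x := Function.leftInverse_invFun hι.injective
  have hιs : ∀ p ∈ zigzagCompactum w, ι (s p) = p := fun p hp => by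
    rw [← hK] at hp
    exact Function.invFun_eq hp.1
  have hs : ContinuousOn s (zigzagCompactum w) := by
    rw [hι.isInducing.continuousOn_iff]
    exact continuousOn_id.congr hιs
  have hmem : ∀ x, 0 ≤ (ι x).1 → ι x ∈ zigzagCompactum w := fun x hx => by
    rw [← hK]; exact ⟨mem_range_self x, hx⟩
  have hAS : ι ⁻¹' {p | p.1 = 1} ∪ ι ⁻¹' {p | p.1 ∈ Ico 0 1} = ι ⁻¹' zigzagCompactum w := by
    ext x
    constructor
    · rintro (hx | hx)
      · exact hmem x (by have hx : (ι x).1 = 1 := hx; rw [hx]; norm_num)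
      · exact hmem x hx.1
    · intro hx
      obtain ⟨h1, -⟩ := zigzagCompactum_subset hx
      rcases h1.2.eq_or_lt with h | h
      · exact .inl h
      · exact .inr ⟨h1.1, h⟩
  have hcurve : ∀ t : Ici (0 : ℝ), ι (s (zigzagCurve w t)) = zigzagCurve w t := fun t =>
    hιs _ (zigzagCurve_mem t.2)
  have hside : ∀ r : Icc (0 : ℝ) 1, ((1, 7 * r) : ℝ × ℝ) ∈ zigzagCompactum w := fun r =>
    .inl ⟨rfl, by have := r.2.1; simp only; linarith, by have := r.2.2; simp only; linarith⟩
  refine ⟨?_, ⟨?_⟩, ?_, ?_, subset_union_right, ?_⟩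
  · refine ⟨⟨⟨fun x => ⟨(ι x).1 / (1 - (ι x).1), ?_⟩, fun t => ⟨s (zigzagCurve w t), ?_⟩, ?_, ?_⟩,
      ?_, ?_⟩, ?_, ?_⟩
    · exact (mem_zigzagCompactum_of_fst_lt (hmem x x.2.1) x.2.2).1
    · rw [mem_preimage, hcurve]
      exact zigzagCurve_fst_mem t.2
    · intro x
      refine Subtype.ext ?_
      simp only [(mem_zigzagCompactum_of_fst_lt (hmem x x.2.1) x.2.2).2, hsι]
    · intro t
      refine Subtype.ext ?_
      simp only [hcurve, zigzagCurve_param t.2]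
    · have h1 : Continuous fun x : ι ⁻¹' {p | p.1 ∈ Ico (0 : ℝ) 1} => (ι x).1 :=
        continuous_fst.comp (hι.continuous.comp continuous_subtype_val)
      refine (h1.div (continuous_const.sub h1) fun x => ?_).subtype_mk _
      exact (sub_pos.2 x.2.2).ne'
    · exact (hs.comp_continuous (continuousOn_zigzagCurve.comp_continuous continuous_subtype_val
        fun t => t.2) fun t => zigzagCurve_mem t.2).subtype_mk _
    · simp [hx₀]
    · simp [hx₀]
  · refine ⟨⟨fun x => ⟨(ι x).2 / 7, ?_⟩, fun r => ⟨s (1, 7 * r), ?_⟩, ?_, ?_⟩, ?_, ?_⟩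
    · have h1 : (ι x).1 = 1 := x.2
      have h2 := (zigzagCompactum_subset (hmem x (by rw [h1]; norm_num))).2
      constructor <;> linarith [h2.1, h2.2]
    · rw [mem_preimage, hιs _ (hside r)]
      rfl
    · intro x
      refine Subtype.ext ?_
      have h1 : (ι x).1 = 1 := x.2
      have h2 : ((1, 7 * ((ι x).2 / 7)) : ℝ × ℝ) = ι x :=
        Prod.ext h1.symm (mul_div_cancel₀ _ (by norm_num))
      simp only [h2, hsι]
    · intro r
      refine Subtype.ext ?_
      simp only [hιs _ (hside r)]
      exact mul_div_cancel_left₀ _ (by norm_num)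
    · exact ((continuous_snd.comp (hι.continuous.comp continuous_subtype_val)).div_const 7).subtype_mk _
    · exact (hs.comp_continuous (by fun_prop) hside).subtype_mk _
  · rw [Set.disjoint_left]
    intro x hx hx'
    exact hx'.2.ne hx
  · rw [hAS, hι.isInducing.isCompact_preimage_iff (by rw [← hK]; exact inter_subset_left)]
    exact isCompact_zigzagCompactum
  · rw [hAS]
    intro x hx
    have h1 := zigzagCompactum_subset_closure hw hx
    rw [hι.isInducing.closure_eq_preimage_closure_image]
    refine closure_mono ?_ h1
    rintro _ ⟨t, ht, rfl⟩
    refine ⟨s (zigzagCurve w t), ?_, hcurve ⟨t, ht⟩⟩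
    rw [mem_preimage, hcurve ⟨t, ht⟩]
    exact zigzagCurve_fst_mem ht

/-- A map between zigzag compacta that sends ray to ray and remainder to remainder. -/
lemma exists_isAsymptoticFactor {F : ℝ × ℝ → ℝ × ℝ} (hF : ContinuousOn F (zigzagCompactum w))
    (hmaps : MapsTo F (zigzagCompactum w) (zigzagCompactum v))
    (hrem : ∀ p ∈ zigzagCompactum w, p.1 = 1 → (F p).1 = 1)
    (hray : ∀ p ∈ zigzagCompactum w, p.1 < 1 → (F p).1 < 1) :
    ∃ α τ T, IsAsymptoticFactor w v α τ T := by
  have hside : ∀ {y : ℝ}, y ∈ Icc (0 : ℝ) 7 → ((1, y) : ℝ × ℝ) ∈ zigzagCompactum w :=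
    fun hy => .inl ⟨rfl, hy⟩
  set α : ℝ → ℝ := fun y => (F (1, y)).2 with hα
  set x : ℝ → ℝ := fun t => (F (zigzagCurve w t)).1 with hx
  set τ : ℝ → ℝ := fun t => x t / (1 - x t) with hτ
  have hx1 : ∀ t, 0 ≤ t → x t < 1 := fun t ht =>
    hray _ (zigzagCurve_mem ht) (zigzagCurve_fst_mem ht).2
  have hτF : ∀ t, 0 ≤ t → 0 ≤ τ t ∧ zigzagCurve v (τ t) = F (zigzagCurve w t) := fun t ht =>
    mem_zigzagCompactum_of_fst_lt (hmaps (zigzagCurve_mem ht)) (hx1 t ht)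
  have hFc : ContinuousOn (fun t => F (zigzagCurve w t)) (Ici 0) :=
    hF.comp continuousOn_zigzagCurve fun t ht => zigzagCurve_mem ht
  have hxc : ContinuousOn x (Ici 0) := continuous_fst.comp_continuousOn hFc
  -- uniform continuity: far out on the ray, `F` nearly agrees with its values on the remainder
  have hclose : ∀ ε > 0, ∃ T, 0 ≤ T ∧ ∀ t, T ≤ t →
      dist (zigzagCurve v (τ t)) (F (1, zigzag w t)) < ε := by
    intro ε hε
    obtain ⟨δ, hδ, h⟩ := Metric.uniformContinuousOn_iff.1
      (isCompact_zigzagCompactum.uniformContinuousOn_of_continuous hF) ε hε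
    refine ⟨1 / δ, by positivity, fun t ht => ?_⟩
    have ht0 : 0 ≤ t := le_trans (by positivity) ht
    rw [(hτF t ht0).2]
    refine h _ (zigzagCurve_mem ht0) _ (hside (zigzag_mem_Icc ht0)) ?_
    rw [dist_zigzagCurve ht0, div_lt_iff₀ (by positivity)]
    rw [div_le_iff₀ hδ] at ht
    linarith
  obtain ⟨T, hT0, hT⟩ := hclose (1 / 8) (by norm_num)
  refine ⟨α, τ, T, hT0, ?_, ?_, fun t ht => (hτF t ht).1, ?_, fun t ht => ?_⟩
  · exact continuous_snd.comp_continuousOn (hF.comp (by fun_prop) fun y hy => hside hy)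
  · refine hxc.div (continuousOn_const.sub hxc) fun t ht => ?_
    have := hx1 t ht
    linarith
  · rw [Filter.tendsto_atTop]
    intro b
    obtain ⟨T', hT'0, hT'⟩ := hclose (1 / (1 + |b|)) (by positivity)
    filter_upwards [Filter.eventually_ge_atTop T'] with t ht
    have ht0 := hT'0.trans ht
    obtain ⟨h0, -⟩ := hτF t ht0
    have h1 := hT' t ht
    rw [Prod.dist_eq] at h1
    replace h1 := (le_max_left _ _).trans_lt h1
    rw [hrem _ (hside (zigzag_mem_Icc ht0)) rfl, Real.dist_eq] at h1
    have h2 : (zigzagCurve v (τ t)).1 - 1 = -(1 / (1 + τ t)) := by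
      simp only [zigzagCurve]; field_simp; ring
    rw [h2, abs_neg, abs_of_nonneg (by positivity),
      div_lt_div_iff₀ (by positivity) (by positivity)] at h1
    linarith [le_abs_self b]
  · have h1 := hT t ht
    rw [Prod.dist_eq] at h1
    replace h1 := (le_max_right _ _).trans_lt h1
    rw [dist_comm, Real.dist_eq] at h1
    exact h1.le

end Compactum

/-! ### Two incomparable compactifications -/

section Incomparable

/-- A map of one of two glued ray compactifications onto the other sends ray to ray and remainder to
remainder, since it permutes path components and the ray is dense. -/
lemma DenseFreeInterval.IsGluingOfRayCompactifications.mapsTo_of_image_eq {X : Type*}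
    [TopologicalSpace X] {L JL JR R : Set X} {x₀ : X}
    (h : IsGluingOfRayCompactifications L JL JR R x₀) {f : X → X} (hf : ContinuousOn f (L ∪ JL))
    (himg : f '' (L ∪ JL) = R ∪ JR) : MapsTo f L R ∧ MapsTo f JL JR := by
  have := h.metrizable
  obtain ⟨κ, j, hκ, -, hr, hJL, hJR⟩ := exists_intervalCoordinate h
  have hd := h.isInClassC
  have hx₀L : x₀ ∈ JL := by obtain ⟨_, hx, _⟩ := h.left.ray; exact hx
  have hx₀R : x₀ ∈ JR := by obtain ⟨_, hx, _⟩ := h.right.ray; exact hx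
  obtain ⟨p, hp⟩ := h.left.arc.nontrivial.nonempty
  have hmaps : MapsTo f (L ∪ JL) (R ∪ JR) := mapsTo_iff_image_subset.2 himg.le
  have hpc : ∀ {P : Set X}, P ⊆ L ∪ JL → IsPathConnected P → P.Nonempty →
      MapsTo f P JR ∨ MapsTo f P R := by
    intro P hP hPc ⟨q, hq⟩
    have h0 : ∀ x ∈ P, 0 ≤ κ (f x) := fun x hx => by
      have := hmaps (hP hx); rw [hr] at this; exact this
    rcases hκ.subset_of_isPathConnected h.left.arc.nontrivial h.right.arc.nontrivial
      (hPc.image' (hf.mono hP)) with h1 | h1 | h1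
    · exact .inl fun x hx => by
        rw [hJR]; exact ⟨h0 x hx, (h1 (mem_image_of_mem f hx)).2⟩
    · have := (hκ.left _).1 (h1 (mem_image_of_mem f hq))
      linarith [h0 q hq]
    · exact .inr (mapsTo_iff_image_subset.2 h1)
  have hRJ : Disjoint R JR := hd.right_disjoint.mono_right subset_union_right
  have hray : MapsTo f JL JR := by
    have hJLc : IsPathConnected JL := hJL ▸ hκ.isPathConnected_preimage (convex_Ioc _ _)
      ⟨0, by norm_num⟩ fun s hs => ⟨hs.1, by linarith [hs.2]⟩
    refine (hpc subset_union_right hJLc ⟨_, hx₀L⟩).resolve_right fun hc => ?_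
    -- otherwise the whole image lies in the remainder
    have hcl : closure JL = L ∪ JL := Subset.antisymm
      (closure_minimal subset_union_right h.left.compactification.1.isClosed)
      h.left.compactification.2.2
    have h1 := hc.closure_of_continuousOn (hcl ▸ hf)
    rw [hcl, h.right.arc.isCompact.isClosed.closure_eq] at h1
    obtain ⟨y, hy, hyx⟩ := himg.ge (.inr hx₀R)
    exact hRJ.le_bot ⟨hyx ▸ h1 hy, hx₀R⟩
  refine ⟨?_, hray⟩
  refine (hpc subset_union_left h.left.arc.isPathConnected ⟨p, hp⟩).resolve_left fun hc => ?_
  obtain ⟨q, hq⟩ := h.right.arc.nontrivial.nonempty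
  obtain ⟨y, hy | hy, hyq⟩ := himg.ge (.inl hq)
  · exact hRJ.le_bot ⟨hq, hyq ▸ hc hy⟩
  · exact hRJ.le_bot ⟨hq, hyq ▸ hray hy⟩

lemma exists_isAsymptoticFactor_of_mapsContinuouslyOnto {X : Type*} [TopologicalSpace X]
    {w v : ℕ → Fin 4} {ι ι' : X → ℝ × ℝ} (hι : IsEmbedding ι) (hι' : IsEmbedding ι') {x₀ : X}
    (h : IsGluingOfRayCompactifications (ι ⁻¹' {p | p.1 = 1}) (ι ⁻¹' {p | p.1 ∈ Ico 0 1})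
      (ι' ⁻¹' {p | p.1 ∈ Ico 0 1}) (ι' ⁻¹' {p | p.1 = 1}) x₀)
    (hK : range ι ∩ {p | 0 ≤ p.1} = zigzagCompactum w)
    (hK' : range ι' ∩ {p | 0 ≤ p.1} = zigzagCompactum v)
    (hf : MapsContinuouslyOnto (ι ⁻¹' {p | p.1 = 1} ∪ ι ⁻¹' {p | p.1 ∈ Ico 0 1})
      (ι' ⁻¹' {p | p.1 = 1} ∪ ι' ⁻¹' {p | p.1 ∈ Ico 0 1})) :
    ∃ α τ T, IsAsymptoticFactor w v α τ T := by
  obtain ⟨f, hf, himg⟩ := hf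
  obtain ⟨hrem, hray⟩ := h.mapsTo_of_image_eq hf himg
  have : Nonempty X := ⟨x₀⟩
  set s : ℝ × ℝ → X := Function.invFun ι
  have hιs : ∀ p ∈ zigzagCompactum w, ι (s p) = p := fun p hp => by
    rw [← hK] at hp
    exact Function.invFun_eq hp.1
  have hs : ContinuousOn s (zigzagCompactum w) := by
    rw [hι.isInducing.continuousOn_iff]
    exact continuousOn_id.congr hιs
  have hs1 : ∀ p ∈ zigzagCompactum w, p.1 = 1 → s p ∈ ι ⁻¹' {p | p.1 = 1} := fun p hp h1 => by
    rw [mem_preimage, hιs p hp]; exact h1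
  have hs2 : ∀ p ∈ zigzagCompactum w, p.1 < 1 → s p ∈ ι ⁻¹' {p | p.1 ∈ Ico 0 1} :=
    fun p hp h1 => by
      rw [mem_preimage, hιs p hp]; exact ⟨(zigzagCompactum_subset hp).1.1, h1⟩
  have hsm : MapsTo s (zigzagCompactum w)
      (ι ⁻¹' {p | p.1 = 1} ∪ ι ⁻¹' {p | p.1 ∈ Ico 0 1}) := fun p hp => by
    rcases (zigzagCompactum_subset hp).1.2.eq_or_lt with h1 | h1
    · exact .inl (hs1 p hp h1)
    · exact .inr (hs2 p hp h1)
  refine exists_isAsymptoticFactor (F := fun p => ι' (f (s p)))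
    (hι'.continuous.comp_continuousOn (hf.comp hs hsm)) (fun p hp => ?_)
    (fun p hp h1 => hrem (hs1 p hp h1)) fun p hp h1 => (hray (hs2 p hp h1)).2
  have h1 := himg.le (mem_image_of_mem f (hsm hp))
  rw [← hK']
  refine ⟨mem_range_self _, ?_⟩
  rcases h1 with h1 | h1
  · have h1 : (ι' (f (s p))).1 = 1 := h1
    simp only [mem_ofPred_eq, h1]
    norm_num
  · exact h1.1

/-- Zigzag compacta along `w` and `v`, the former reflected, glued at the end points of the two
rays. -/
def gluedZigzags (w v : ℕ → Fin 4) : Set (ℝ × ℝ) :=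
  {p | (-p.1, p.2) ∈ zigzagCompactum w} ∪ zigzagCompactum v

lemma zigzag_zero {w : ℕ → Fin 4} (hw : w 0 = 0) : zigzag w 0 = 0 := by
  have := linearInterpolation_natCast (V := zigzagVertex w) 0
  rw [Nat.cast_zero] at this
  simp [zigzag, this, zigzagVertex, hw]

lemma eq_zero_of_mem_zigzagCompactum {w : ℕ → Fin 4} (hw : w 0 = 0) {p : ℝ × ℝ}
    (hp : p ∈ zigzagCompactum w) (h : p.1 = 0) : p = (0, 0) := by
  obtain ⟨-, h1⟩ := mem_zigzagCompactum_of_fst_lt hp (by rw [h]; exact one_pos)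
  rw [← h1, h]
  simp [zigzagCurve, zigzag_zero hw]

lemma zero_mem_zigzagCompactum {w : ℕ → Fin 4} (hw : w 0 = 0) :
    ((0, 0) : ℝ × ℝ) ∈ zigzagCompactum w := by
  have := zigzagCurve_mem (w := w) le_rfl
  simpa [zigzagCurve, zigzag_zero hw] using this

/-- The two zigzag compacta inside `gluedZigzags w v` do not map onto each other if neither walk is
an asymptotic factor of the other. -/
lemma exists_gluing_of_not_isAsymptoticFactor {w v : ℕ → Fin 4} (hw0 : w 0 = 0) (hv0 : v 0 = 0)
    (hw : ∀ p, ∃ᶠ i in Filter.atTop, w i = p) (hv : ∀ p, ∃ᶠ i in Filter.atTop, v i = p)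
    (hwv : ¬ ∃ α τ T, IsAsymptoticFactor w v α τ T)
    (hvw : ¬ ∃ α τ T, IsAsymptoticFactor v w α τ T) :
    ∃ (X : Type) (_ : TopologicalSpace X) (L JL JR R : Set X) (x₀ : X),
      IsGluingOfRayCompactifications L JL JR R x₀ ∧
      ¬ MapsContinuouslyOnto (L ∪ JL) (R ∪ JR) ∧
      ¬ MapsContinuouslyOnto (R ∪ JR) (L ∪ JL) := by
  set ι' : gluedZigzags w v → ℝ × ℝ := Subtype.val with hι'_def
  set ι : gluedZigzags w v → ℝ × ℝ := fun p => (-p.1.1, p.1.2) with hι_def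
  have hι' : IsEmbedding ι' := .subtypeVal
  have hι : IsEmbedding ι :=
    ((Homeomorph.neg ℝ).prodCongr (Homeomorph.refl ℝ)).isEmbedding.comp .subtypeVal
  have hK' : range ι' ∩ {p | 0 ≤ p.1} = zigzagCompactum v := by
    ext p
    rw [hι'_def, Subtype.range_coe]
    constructor
    · rintro ⟨hp | hp, h0⟩
      · have h1 : 0 ≤ -p.1 := (zigzagCompactum_subset hp).1.1
        have h0 : 0 ≤ p.1 := h0
        have h2 := eq_zero_of_mem_zigzagCompactum hw0 hp (by simp only; linarith)
        obtain ⟨h3, h4⟩ := Prod.ext_iff.1 h2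
        have : p = (0, 0) := Prod.ext (by simpa using h3) h4
        rw [this]
        exact zero_mem_zigzagCompactum hv0
      · exact hp
    · exact fun hp => ⟨.inr hp, (zigzagCompactum_subset hp).1.1⟩
  have hK : range ι ∩ {p | 0 ≤ p.1} = zigzagCompactum w := by
    ext p
    constructor
    · rintro ⟨⟨⟨q, hq⟩, rfl⟩, h0⟩
      rcases hq with hq | hq
      · exact hq
      · have h1 : 0 ≤ q.1 := (zigzagCompactum_subset hq).1.1
        have h0 : 0 ≤ -q.1 := h0
        have h2 := eq_zero_of_mem_zigzagCompactum hv0 hq (by linarith)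
        subst h2
        simpa [hι_def] using zero_mem_zigzagCompactum hw0
    · exact fun hp => ⟨⟨⟨(-p.1, p.2), .inl (by simpa using hp)⟩, by simp [hι_def]⟩,
        (zigzagCompactum_subset hp).1.1⟩
  set x₀ : gluedZigzags w v := ⟨(0, 0), .inr (zero_mem_zigzagCompactum hv0)⟩
  have hunion : ∀ x : gluedZigzags w v,
      (x ∈ ι ⁻¹' {p | p.1 = 1} ∪ ι ⁻¹' {p | p.1 ∈ Ico 0 1} ↔ x.1.1 ≤ 0) ∧
      (x ∈ ι' ⁻¹' {p | p.1 = 1} ∪ ι' ⁻¹' {p | p.1 ∈ Ico 0 1} ↔ 0 ≤ x.1.1) := by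
    intro x
    have hx : -1 ≤ x.1.1 ∧ x.1.1 ≤ 1 := by
      rcases x.2 with h | h
      · have := (zigzagCompactum_subset h).1
        exact ⟨by linarith [this.2], by linarith [this.1]⟩
      · have := (zigzagCompactum_subset h).1
        exact ⟨by linarith [this.1], this.2⟩
    simp only [mem_union, mem_preimage, mem_ofPred_eq, mem_Ico, hι_def, hι'_def]
    refine ⟨⟨?_, fun h => ?_⟩, ⟨?_, fun h => ?_⟩⟩
    · rintro (h | h) <;> linarith
    · rcases hx.1.eq_or_lt with h1 | h1
      · exact .inl (by linarith)
      · exact .inr ⟨by linarith, by linarith⟩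
    · rintro (h | h) <;> linarith
    · rcases hx.2.eq_or_lt with h1 | h1
      · exact .inl h1
      · exact .inr ⟨h, h1⟩
  have hgl : IsGluingOfRayCompactifications (ι ⁻¹' {p | p.1 = 1}) (ι ⁻¹' {p | p.1 ∈ Ico 0 1})
      (ι' ⁻¹' {p | p.1 ∈ Ico 0 1}) (ι' ⁻¹' {p | p.1 = 1}) x₀ :=
  { metrizable := inferInstance
    left := isRayCompactification_of_isEmbedding hι hw hK (by simp [hι_def, x₀])
    right := isRayCompactification_of_isEmbedding hι' hv hK' rfl
    cover := by
      refine eq_univ_of_forall fun x => ?_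
      rcases le_total x.1.1 0 with h | h
      · exact .inl ((hunion x).1.2 h)
      · exact .inr ((hunion x).2.2 h)
    inter := by
      ext x
      rw [mem_inter_iff, (hunion x).1, (hunion x).2, mem_singleton_iff]
      constructor
      · rintro ⟨h1, h2⟩
        have h3 : x.1 ∈ zigzagCompactum v := by
          rw [← hK']; exact ⟨mem_range_self x, h2⟩
        exact Subtype.ext (eq_zero_of_mem_zigzagCompactum hv0 h3 (le_antisymm h1 h2))
      · rintro rfl
        exact ⟨le_rfl, le_rfl⟩ }
  exact ⟨gluedZigzags w v, inferInstance, _, _, _, _, x₀, hgl,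
    fun hf => hwv (exists_isAsymptoticFactor_of_mapsContinuouslyOnto hι hι' hgl hK hK' hf),
    fun hf => hvw (exists_isAsymptoticFactor_of_mapsContinuouslyOnto hι' hι hgl.symm hK' hK hf)⟩

/-- One period of a walk which, besides its turns at the ends `0` and `3`, makes the turn
`0, 1, 0`. -/
def lowTurnCycle : ZMod 8 → Fin 4 := ![0, 1, 2, 3, 2, 1, 0, 1]

/-- One period of a walk which, besides its turns at the ends `0` and `3`, makes the turn
`2, 1, 2`. -/
def highTurnCycle : ZMod 10 → Fin 4 := ![0, 1, 2, 3, 2, 1, 2, 3, 2, 1]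

lemma frequently_natCast_zmod {n : ℕ} [NeZero n] {P : ZMod n → Prop} (h : ∃ k, P k) :
    ∃ᶠ i : ℕ in Filter.atTop, P i := by
  obtain ⟨k, hk⟩ := h
  rw [Filter.frequently_atTop]
  intro a
  refine ⟨k.val + n * a, ?_, by simpa using hk⟩
  have := Nat.le_mul_of_pos_left a (NeZero.pos n)
  omega

/-- The turns of a periodic walk lift to turns of another one of which it is an asymptotic
factor. -/
lemma IsAsymptoticFactor.exists_injective_turns_of_periodic {m n : ℕ} [NeZero n]
    {a : ZMod m → Fin 4} {b : ZMod n → Fin 4} {α τ : ℝ → ℝ} {T : ℝ}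
    (H : IsAsymptoticFactor (fun i => a i) (fun i => b i) α τ T) (ha : ∀ k, a k ≠ a (k + 1))
    (hb : ∀ p, ∃ k, b k = p) :
    ∃ ρ : Fin 4 → Fin 4, Function.Injective ρ ∧ ∀ p p' : Fin 4,
      ((p : ℕ) = p' + 1 ∨ (p' : ℕ) = p + 1) → (∃ k, b k = p' ∧ b (k + 1) = p ∧ b (k + 2) = p') →
      ∃ k, a k = ρ p' ∧ a (k + 1) = ρ p ∧ a (k + 2) = ρ p' := by
  obtain ⟨ρ, hρ, h⟩ := H.exists_injective_turns (fun i => by simpa using ha i)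
    fun p => frequently_natCast_zmod (hb p)
  refine ⟨ρ, hρ, fun p p' hpp hk => ?_⟩
  obtain ⟨i, hi⟩ := h p p' hpp (by simpa using frequently_natCast_zmod hk)
  exact ⟨i, by simpa using hi⟩

/-- The two turns `2, 1, 2` and `2, 3, 2` of the second walk have the same base, which no two
different turns of the first walk have. -/
lemma not_isAsymptoticFactor_low_high :
    ¬ ∃ α τ T, IsAsymptoticFactor (fun i => lowTurnCycle i) (fun i => highTurnCycle i) α τ T := by
  rintro ⟨α, τ, T, H⟩
  obtain ⟨ρ, hρ, h⟩ := H.exists_injective_turns_of_periodic (by decide) (by decide)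
  obtain ⟨k, h1, h2, h3⟩ := h 1 2 (by decide) (by decide)
  obtain ⟨k', h1', h2', h3'⟩ := h 3 2 (by decide) (by decide)
  have key : ∀ k k' : ZMod 8, lowTurnCycle k = lowTurnCycle (k + 2) →
      lowTurnCycle k' = lowTurnCycle (k' + 2) → lowTurnCycle k = lowTurnCycle k' →
      lowTurnCycle (k + 1) = lowTurnCycle (k' + 1) := by decide
  have := key k k' (by rw [h1, h3]) (by rw [h1', h3']) (by rw [h1, h1'])
  rw [h2, h2'] at this
  exact absurd (hρ this) (by decide)

/-- The turns `0, 1, 0` and `1, 0, 1` of the first walk are inverse to each other, while the second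
walk does not make a turn together with its inverse. -/
lemma not_isAsymptoticFactor_high_low :
    ¬ ∃ α τ T, IsAsymptoticFactor (fun i => highTurnCycle i) (fun i => lowTurnCycle i) α τ T := by
  rintro ⟨α, τ, T, H⟩
  obtain ⟨ρ, -, h⟩ := H.exists_injective_turns_of_periodic (by decide) (by decide)
  obtain ⟨k, h1, h2, h3⟩ := h 1 0 (by decide) (by decide)
  obtain ⟨k', h1', h2', h3'⟩ := h 0 1 (by decide) (by decide)
  have key : ∀ k k' : ZMod 10, highTurnCycle k = highTurnCycle (k + 2) →
      highTurnCycle k' = highTurnCycle (k' + 2) → highTurnCycle k = highTurnCycle (k' + 1) →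
      highTurnCycle (k + 1) ≠ highTurnCycle k' := by decide
  exact key k k' (by rw [h1, h3]) (by rw [h1', h3']) (by rw [h1, h2']) (by rw [h2, h1'])

theorem exists_gluing_not_mapsContinuouslyOnto :
    ∃ (X : Type) (_ : TopologicalSpace X) (L JL JR R : Set X) (x₀ : X),
      IsGluingOfRayCompactifications L JL JR R x₀ ∧
      ¬ MapsContinuouslyOnto (L ∪ JL) (R ∪ JR) ∧
      ¬ MapsContinuouslyOnto (R ∪ JR) (L ∪ JL) :=
  exists_gluing_of_not_isAsymptoticFactor (w := fun i => lowTurnCycle i)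
    (v := fun i => highTurnCycle i) (by simp [lowTurnCycle]) (by simp [highTurnCycle])
    (fun p => frequently_natCast_zmod ((by decide : ∀ p, ∃ k, lowTurnCycle k = p) p))
    (fun p => frequently_natCast_zmod ((by decide : ∀ p, ∃ k, highTurnCycle k = p) p))
    not_isAsymptoticFactor_low_high not_isAsymptoticFactor_high_low

end Incomparable

theorem mainTheorem8 :
    (∃ (X : Type) (_ : TopologicalSpace X) (L JL JR R : Set X) (x₀ : X),
      IsGluingOfRayCompactifications L JL JR R x₀ ∧
      ¬ MapsContinuouslyOnto (L ∪ JL) (R ∪ JR) ∧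
      ¬ MapsContinuouslyOnto (R ∪ JR) (L ∪ JL)) ∧
    (∀ (X : Type*) [TopologicalSpace X] (L JL JR R : Set X) (x₀ : X),
      IsGluingOfRayCompactifications L JL JR R x₀ →
      ¬ MapsContinuouslyOnto (L ∪ JL) (R ∪ JR) →
      ¬ MapsContinuouslyOnto (R ∪ JR) (L ∪ JL) →
      IsInClassC L (JL ∪ JR) R ∧ L.Nontrivial ∧ R.Nontrivial ∧ IsArc L ∧ IsArc R ∧
      Disjoint L R ∧
      minimalSets (univ : Set X) = minimalSets (JL ∪ JR) ∪ minimalSets L ∪ minimalSets R ∧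
      Disjoint (minimalSets (JL ∪ JR)) (minimalSets L) ∧
      Disjoint (minimalSets (JL ∪ JR)) (minimalSets R) ∧
      Disjoint (minimalSets L) (minimalSets R) ∧
      ∀ M ∈ minimalSets (univ : Set X), ¬ ((M ∩ L).Nonempty ∧ (M ∩ R).Nonempty)) := by
  refine ⟨exists_gluing_not_mapsContinuouslyOnto, fun X _ L JL JR R x₀ h hLR hRL => ?_⟩
  exact ⟨h.isInClassC, h.left.arc.nontrivial, h.right.arc.nontrivial, h.left.arc, h.right.arc,
    minimalSets_of_gluing h hLR hRL⟩
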